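/- Let $s\ge 1$ and let $$\mathbb{R}H_{s,s}=\Big\{\big([x_0,\dots,x_s],[y_0,\dots,y_s]\big)\in\mathbb{R}P^s\times\mathbb{R}P^s \;\Big|\; x_0y_0+\dots+x_sy_s=0\Big\}$$ be the real Milnor manifold, with the subspace topology. Let $A:\mathbb{R}H_{s,s}\to\mathbb{R}H_{s,s}$ be the continuous map $A([x],[y])=([y],[x])$; it is an involution without fixed points. Let $H^*$ denote singular cohomology with $\mathbb{Z}/2$ coefficients, let $u$ be the generator (the unique nonzero element) of $H^1(\mathbb{R}P^s)\cong\mathbb{Z}/2$, and let $a,b\in H^1(\mathbb{R}H_{s,s})$ be the pullbacks of $u$ along the projections $([x],[y])\mapsto[x]$ and $([x],[y])\mapsto[y]$ respectively. Then $a$ and $b$ span the $\mathbb{Z}/2$-vector space $H^1(\mathbb{R}H_{s,s})$, they are linearly independent if $s\ge 2$, and $$A^*(a)=b .$$ In particular, if $s\ge 2$, then $A^*: H^1(\mathbb{R}H_{s,s})\to H^1(\mathbb{R}H_{s,s})$ is not the identity, so $A$ acts nontrivially on mod 2 cohomology. -/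

import Mathlib

open scoped LinearAlgebra.Projectivization

noncomputable section

namespace Milnor

/-! ### Singular cohomology with coefficients in `ℤ/2` -/

/-- Singular `n`-simplices of `X`: continuous maps from the standard `n`-simplex to `X`. -/
abbrev SingularSimplex (n : ℕ) (X : Type*) [TopologicalSpace X] : Type _ :=
  C(stdSimplex ℝ (Fin (n + 1)), X)

/-- The inclusion of the standard `n`-simplex as the face of the standard `(n+1)`-simplex
opposite to the vertex `i`. -/
def faceInclusion (n : ℕ) (i : Fin (n + 2)) :
    C(stdSimplex ℝ (Fin (n + 1)), stdSimplex ℝ (Fin (n + 2))) :=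
  ⟨stdSimplex.map i.succAbove, stdSimplex.continuous_map _⟩

/-- The singular `n`-cochains of `X` with coefficients in `ℤ/2`. -/
abbrev Cochain (n : ℕ) (X : Type*) [TopologicalSpace X] : Type _ :=
  SingularSimplex n X → ZMod 2

/-- The singular coboundary operator. With `ℤ/2` coefficients the signs disappear. -/
def coboundary (n : ℕ) (X : Type*) [TopologicalSpace X] :
    Cochain n X →ₗ[ZMod 2] Cochain (n + 1) X where
  toFun c := fun σ => ∑ i : Fin (n + 2), c (σ.comp (faceInclusion n i))
  map_add' c d := by
    ext σ
    simp [Finset.sum_add_distrib]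
  map_smul' r c := by
    ext σ
    simp [Finset.mul_sum]

/-- The singular `n`-cocycles of `X` with coefficients in `ℤ/2`. -/
def cocycles (n : ℕ) (X : Type*) [TopologicalSpace X] : Submodule (ZMod 2) (Cochain n X) :=
  LinearMap.ker (coboundary n X)

/-- The singular `n`-coboundaries of `X` with coefficients in `ℤ/2`. -/
def coboundaries (n : ℕ) (X : Type*) [TopologicalSpace X] : Submodule (ZMod 2) (Cochain n X) :=
  match n with
  | 0 => ⊥
  | m + 1 => LinearMap.range (coboundary m X)

theorem coboundary_coboundary (n : ℕ) (X : Type*) [TopologicalSpace X] (c : Cochain n X) :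
    coboundary (n + 1) X (coboundary n X c) = 0 := by
  ext σ
  change ∑ i : Fin (n + 3), ∑ j : Fin (n + 2),
    c ((σ.comp (faceInclusion (n + 1) i)).comp (faceInclusion n j)) = 0
  rw [← Finset.sum_product']
  refine Finset.sum_involution
    (fun p _ => (p.1.succAbove p.2, p.2.predAbove p.1)) ?_ ?_ ?_ ?_
  · rintro ⟨i, j⟩ -
    have h : (σ.comp (faceInclusion (n + 1) (i.succAbove j))).comp
        (faceInclusion n (j.predAbove i)) =
        (σ.comp (faceInclusion (n + 1) i)).comp (faceInclusion n j) := by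
      ext x
      simp only [ContinuousMap.comp_apply, faceInclusion, ContinuousMap.coe_mk]
      rw [stdSimplex.map_comp_apply, stdSimplex.map_comp_apply]
      congr 2
      funext k
      exact Fin.succAbove_succAbove_succAbove_predAbove i j k
    change c _ + c _ = 0
    rw [h]
    exact CharTwo.add_self_eq_zero _
  · rintro ⟨i, j⟩ - - h
    exact Fin.succAbove_ne i j (congrArg Prod.fst h)
  · intro p _
    simp
  · rintro ⟨i, j⟩ -
    refine Prod.ext (Fin.succAbove_succAbove_predAbove i j) ?_
    exact Fin.predAbove_predAbove_succAbove i j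

theorem coboundaries_le_cocycles (n : ℕ) (X : Type*) [TopologicalSpace X] :
    coboundaries n X ≤ cocycles n X := by
  cases n with
  | zero => exact bot_le
  | succ m =>
    rintro _ ⟨c, rfl⟩
    exact coboundary_coboundary m X c

/-- The singular cohomology `Hⁿ(X; ℤ/2)`: cocycles modulo coboundaries. -/
abbrev Cohomology (n : ℕ) (X : Type*) [TopologicalSpace X] : Type _ :=
  cocycles n X ⧸ (coboundaries n X).submoduleOf (cocycles n X)

section Functoriality

variable {X Y : Type*} [TopologicalSpace X] [TopologicalSpace Y]

/-- The pullback of singular cochains along a continuous map. -/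
def cochainMap (n : ℕ) (f : C(X, Y)) : Cochain n Y →ₗ[ZMod 2] Cochain n X where
  toFun c := fun σ => c (f.comp σ)
  map_add' _ _ := rfl
  map_smul' _ _ := rfl

theorem coboundary_cochainMap (n : ℕ) (f : C(X, Y)) (c : Cochain n Y) :
    coboundary n X (cochainMap n f c) = cochainMap (n + 1) f (coboundary n Y c) := rfl

theorem cochainMap_mem_cocycles (n : ℕ) (f : C(X, Y)) (c : Cochain n Y)
    (hc : c ∈ cocycles n Y) : cochainMap n f c ∈ cocycles n X := by
  change coboundary n X (cochainMap n f c) = 0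
  rw [coboundary_cochainMap, show coboundary n Y c = 0 from hc, map_zero]

theorem cochainMap_mem_coboundaries (n : ℕ) (f : C(X, Y)) (c : Cochain n Y)
    (hc : c ∈ coboundaries n Y) : cochainMap n f c ∈ coboundaries n X := by
  cases n with
  | zero =>
    rw [show c = 0 from hc, map_zero]
    exact zero_mem _
  | succ m =>
    obtain ⟨e, rfl⟩ := hc
    exact ⟨cochainMap m f e, coboundary_cochainMap m f e⟩

/-- The map `f^* : Hⁿ(Y; ℤ/2) → Hⁿ(X; ℤ/2)` induced by a continuous map `f : X → Y`. -/
def cohomologyMap (n : ℕ) (f : C(X, Y)) :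
    Cohomology n Y →ₗ[ZMod 2] Cohomology n X :=
  Submodule.mapQ _ _
    ((cochainMap n f).restrict (fun c hc => cochainMap_mem_cocycles n f c hc))
    (fun c hc => cochainMap_mem_coboundaries n f c.1 hc)

end Functoriality

/-! ### Real projective space and the real Milnor manifold -/

/-- Real projective space `ℝP^s` with homogeneous coordinates `[x₀, …, x_s]`. -/
def RealProjectiveSpace (s : ℕ) : Type :=
  ℙ ℝ (Fin (s + 1) → ℝ)

/-- `ℝP^s` carries the quotient topology of `ℝ^{s+1} ∖ {0}`. -/
instance (s : ℕ) : TopologicalSpace (RealProjectiveSpace s) :=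
  TopologicalSpace.coinduced
    (Projectivization.mk' ℝ : {v : Fin (s + 1) → ℝ // v ≠ 0} → ℙ ℝ (Fin (s + 1) → ℝ))
    inferInstance

/-- The point `[x₀, …, x_s]` of `ℝP^s`. -/
def RealProjectiveSpace.mk {s : ℕ} (x : Fin (s + 1) → ℝ) (hx : x ≠ 0) : RealProjectiveSpace s :=
  Projectivization.mk ℝ x hx

/-- The set of pairs `([x], [y])` in `ℝP^s × ℝP^s` with `x₀ y₀ + ⋯ + x_s y_s = 0`. -/
def realMilnorSet (s : ℕ) : Set (RealProjectiveSpace s × RealProjectiveSpace s) :=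
  {p | Projectivization.orthogonal (F := ℝ) (m := Fin (s + 1)) p.1 p.2}

theorem mk_mem_realMilnorSet {s : ℕ} (x y : Fin (s + 1) → ℝ) (hx : x ≠ 0) (hy : y ≠ 0) :
    (RealProjectiveSpace.mk x hx, RealProjectiveSpace.mk y hy) ∈ realMilnorSet s ↔
      ∑ i, x i * y i = 0 :=
  Iff.rfl

/-- The real Milnor manifold `ℝH_{s,s}`, with the subspace topology from `ℝP^s × ℝP^s`. -/
abbrev RealMilnor (s : ℕ) : Type := realMilnorSet s

/-- The projection `ℝH_{s,s} → ℝP^s`, `([x], [y]) ↦ [x]`. -/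
def projFst (s : ℕ) : C(RealMilnor s, RealProjectiveSpace s) :=
  ⟨fun p => p.1.1, continuous_fst.comp continuous_subtype_val⟩

/-- The projection `ℝH_{s,s} → ℝP^s`, `([x], [y]) ↦ [y]`. -/
def projSnd (s : ℕ) : C(RealMilnor s, RealProjectiveSpace s) :=
  ⟨fun p => p.1.2, continuous_snd.comp continuous_subtype_val⟩

/-- The map `A : ℝH_{s,s} → ℝH_{s,s}`, `([x], [y]) ↦ ([y], [x])`. -/
def swapMap (s : ℕ) : C(RealMilnor s, RealMilnor s) :=
  ⟨fun p => ⟨(p.1.2, p.1.1), Projectivization.orthogonal_comm.mp p.2⟩,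
    Continuous.subtype_mk (continuous_swap.comp continuous_subtype_val) _⟩

end Milnor

end

/-!
The proof works directly with singular `1`-cochains modulo `2` and never mentions fundamental groups,
covering spaces or spectral sequences.

*The generator.* Every map from a simplex to `ℝP^s` lifts to nonzero vectors (`exists_isLift`):
cut a contraction of the simplex into small steps and project orthogonally from each line to the
next. Choosing a ray on every line arbitrarily, let the cocycle `tautCochain` record whether the
lift of a path takes the chosen ray at the start to the chosen ray at the end. Its class is the
first Stiefel–Whitney class of the tautological line bundle; it is nonzero because a projective
line is a loop whose lift goes from `v` to `-v`.

*Upper bounds.* Let `q : E → ℝP^s` be a space over projective space such that the preimages of the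
two components of each overlap of affine charts are path connected. A `1`-cocycle on `E` which is a
coboundary over each chart is cohomologous to a multiple of the pullback of `tautCochain`
(`exists_sub_smul_tautCochain_mem_coboundaries`). Indeed the primitives over the charts, normalized
at a point with all coordinates positive, agree where `xᵢ xⱼ > 0` and differ by a constant where
`xᵢ xⱼ < 0`, the same for all pairs `i ≠ j`; the same transition functions arise from
`tautCochain`. For `q = id` the charts are contractible, so `H¹(ℝP^s)` is spanned by the
tautological class `u`. For the first projection of the Milnor manifold, a straight-line homotopy
(`slide`) deforms the preimage of each chart into the same fibre, the copy of `ℝP^{s-1}` over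
`[1, …, 1]`. There a cocycle is a multiple of the restriction of `b`; after subtracting that
multiple of `b` the cocycle is a coboundary over each chart, hence a multiple of `a`.

*Independence.* On this fibre `a` restricts to zero and `b` to the generator, which is nonzero if
`s ≥ 2`. So a relation between `a` and `b` does not involve `b`, and since `A` exchanges the two
classes it does not involve `a` either.
-/

noncomputable section

namespace Milnor

/-! ### Singular 1-cocycles: homotopy invariance and locality -/

section Cochains

variable {X Y E : Type*} [TopologicalSpace X] [TopologicalSpace Y]
  [AddCommGroup E] [Module ℝ E] [TopologicalSpace E] [ContinuousAdd E] [ContinuousSMul ℝ E]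

/-- The affine singular simplex with prescribed vertices in a real topological vector space. -/
def affineSimplex {n : ℕ} (p : Fin (n + 1) → E) : SingularSimplex n E where
  toFun t := ∑ i, t i • p i
  continuous_toFun := by
    refine continuous_finsetSum _ fun i _ => ?_
    exact ((continuous_apply i).comp continuous_subtype_val).smul continuous_const

theorem affineSimplex_apply {n : ℕ} (p : Fin (n + 1) → E) (t : stdSimplex ℝ (Fin (n + 1))) :
    affineSimplex p t = ∑ i, t i • p i := rfl

theorem affineSimplex_comp_faceInclusion {n : ℕ} (p : Fin (n + 2) → E) (i : Fin (n + 2)) :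
    (affineSimplex p).comp (faceInclusion n i) = affineSimplex (p ∘ i.succAbove) := by
  ext t
  simp only [ContinuousMap.comp_apply, affineSimplex_apply, faceInclusion, ContinuousMap.coe_mk,
    stdSimplex.map_coe, FunOnFinite.linearMap_apply_apply, Finset.sum_smul, Function.comp]
  rw [← Finset.sum_fiberwise Finset.univ i.succAbove]
  refine Finset.sum_congr rfl fun j _ => Finset.sum_congr rfl fun k hk => ?_
  rw [(Finset.mem_filter.1 hk).2]

/-- The straight segment from `a` to `b`, as a singular `1`-simplex. -/
def edge (a b : E) : SingularSimplex 1 E := affineSimplex ![a, b]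

theorem edge_apply (a b : E) (t : stdSimplex ℝ (Fin 2)) : edge a b t = t 0 • a + t 1 • b := by
  simp [edge, affineSimplex_apply, Fin.sum_univ_two]

theorem edge_vertex_zero (a b : E) : edge a b (stdSimplex.vertex 0) = a := by
  simp [edge_apply]

theorem edge_vertex_one (a b : E) : edge a b (stdSimplex.vertex 1) = b := by
  simp [edge_apply]

/-- A `1`-cocycle is additive along the boundary of an affine triangle. -/
theorem cocycle_edge_add {c : Cochain 1 X} (hc : c ∈ cocycles 1 X) (F : C(E, X)) (a b d : E) :
    c (F.comp (edge a b)) + c (F.comp (edge b d)) = c (F.comp (edge a d)) := by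
  have h : coboundary 1 X c (F.comp (affineSimplex ![a, b, d])) = 0 := congrFun hc _
  change ∑ i : Fin 3, c ((F.comp (affineSimplex ![a, b, d])).comp (faceInclusion 1 i)) = 0 at h
  simp only [ContinuousMap.comp_assoc, affineSimplex_comp_faceInclusion] at h
  have h0 : (![a, b, d] ∘ (0 : Fin 3).succAbove) = ![b, d] := by
    ext j; fin_cases j <;> rfl
  have h1 : (![a, b, d] ∘ (1 : Fin 3).succAbove) = ![a, d] := by
    ext j; fin_cases j <;> rfl
  have h2 : (![a, b, d] ∘ (2 : Fin 3).succAbove) = ![a, b] := by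
    ext j; fin_cases j <;> rfl
  rw [Fin.sum_univ_three, h0, h1, h2] at h
  simp only [edge]
  generalize c (F.comp (affineSimplex ![b, d])) = p at *
  generalize c (F.comp (affineSimplex ![a, d])) = q at *
  generalize c (F.comp (affineSimplex ![a, b])) = r at *
  revert p q r
  decide

theorem cocycle_edge_self {c : Cochain 1 X} (hc : c ∈ cocycles 1 X) (F : C(E, X)) (a : E) :
    c (F.comp (edge a a)) = 0 := by
  simpa using cocycle_edge_add hc F a a a

theorem cocycle_const {c : Cochain 1 X} (hc : c ∈ cocycles 1 X) (x : X) :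
    c (ContinuousMap.const _ x) = 0 :=
  cocycle_edge_self hc (ContinuousMap.const ℝ x) 0

theorem comp_faceInclusion_zero (σ : SingularSimplex 1 X) (t : stdSimplex ℝ (Fin 1)) :
    σ.comp (faceInclusion 0 0) t = σ (stdSimplex.vertex 1) := by
  have : t = stdSimplex.vertex 0 := Subsingleton.elim _ _
  subst this
  simp only [ContinuousMap.comp_apply, faceInclusion, ContinuousMap.coe_mk, stdSimplex.map_vertex]
  rfl

theorem comp_faceInclusion_one (σ : SingularSimplex 1 X) (t : stdSimplex ℝ (Fin 1)) :
    σ.comp (faceInclusion 0 1) t = σ (stdSimplex.vertex 0) := by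
  have : t = stdSimplex.vertex 0 := Subsingleton.elim _ _
  subst this
  simp only [ContinuousMap.comp_apply, faceInclusion, ContinuousMap.coe_mk, stdSimplex.map_vertex]
  rfl

/-- A `1`-cochain is a coboundary iff it is the difference of the values of some (not necessarily
continuous) function at the two endpoints. -/
theorem mem_coboundaries_one_iff {c : Cochain 1 X} :
    c ∈ coboundaries 1 X ↔ ∃ g : X → ZMod 2, ∀ σ : SingularSimplex 1 X,
      c σ = g (σ (stdSimplex.vertex 0)) + g (σ (stdSimplex.vertex 1)) := by
  constructor
  · rintro ⟨e, rfl⟩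
    refine ⟨fun x => e (ContinuousMap.const _ x), fun σ => ?_⟩
    change ∑ i : Fin 2, e (σ.comp (faceInclusion 0 i)) = _
    rw [Fin.sum_univ_two, add_comm]
    congr 2
    · ext t; exact comp_faceInclusion_one σ t
    · ext t; exact comp_faceInclusion_zero σ t
  · rintro ⟨g, hg⟩
    refine ⟨fun τ => g (τ (stdSimplex.vertex 0)), ?_⟩
    ext σ
    change ∑ i : Fin 2, g (σ.comp (faceInclusion 0 i) _) = _
    rw [Fin.sum_univ_two, comp_faceInclusion_zero, comp_faceInclusion_one, hg, add_comm]

/-- The retraction of the real line onto the standard `1`-simplex. -/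
def lineToSimplex : C(ℝ, stdSimplex ℝ (Fin 2)) where
  toFun t := stdSimplexHomeomorphUnitInterval.symm (Set.projIcc 0 1 zero_le_one t)
  continuous_toFun := (Homeomorph.continuous _).comp continuous_projIcc

theorem lineToSimplex_edge (t : stdSimplex ℝ (Fin 2)) : lineToSimplex (edge 0 1 t) = t := by
  change stdSimplexHomeomorphUnitInterval.symm (Set.projIcc 0 1 zero_le_one (edge 0 1 t)) = t
  rw [Homeomorph.symm_apply_eq]
  have h : edge (0 : ℝ) 1 t = t 1 := by simp [edge_apply]
  rw [h, Set.projIcc_of_mem zero_le_one ⟨stdSimplex.zero_le t 1, stdSimplex.le_one t 1⟩]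
  rfl

theorem lineToSimplex_zero : lineToSimplex 0 = stdSimplex.vertex 0 := by
  rw [← lineToSimplex_edge (stdSimplex.vertex 0), edge_vertex_zero]

theorem lineToSimplex_one : lineToSimplex 1 = stdSimplex.vertex 1 := by
  rw [← lineToSimplex_edge (stdSimplex.vertex 1), edge_vertex_one]

theorem comp_lineToSimplex_edge (σ : SingularSimplex 1 X) :
    (σ.comp lineToSimplex).comp (edge 0 1) = σ := by
  ext t
  exact congrArg σ (lineToSimplex_edge t)

/-- Homotopy invariance of first cohomology: the ends of a homotopy pull a `1`-cocycle back to
cohomologous cocycles. The homotopy has the whole real line as its parameter space, which avoids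
restricting affine simplices to the unit square. -/
theorem cochainMap_sub_cochainMap_mem_coboundaries {c : Cochain 1 X} (hc : c ∈ cocycles 1 X)
    (H : C(ℝ × Y, X)) (f₀ f₁ : C(Y, X)) (h₀ : ∀ y, H (0, y) = f₀ y) (h₁ : ∀ y, H (1, y) = f₁ y) :
    cochainMap 1 f₀ c - cochainMap 1 f₁ c ∈ coboundaries 1 Y := by
  rw [mem_coboundaries_one_iff]
  let S (y : Y) : C(ℝ, X) := H.comp (⟨fun t => (t, y), by fun_prop⟩)
  refine ⟨fun y => c ((S y).comp (edge 0 1)), fun τ => ?_⟩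
  change c (f₀.comp τ) - c (f₁.comp τ) = _
  -- the square spanned by `τ` and the homotopy, cut along its diagonal
  let F : C(ℝ × ℝ, X) := H.comp
    ⟨fun p => (p.1, τ (lineToSimplex p.2)), by fun_prop⟩
  have e₁ := cocycle_edge_add hc F (0, 0) (0, 1) (1, 1)
  have e₂ := cocycle_edge_add hc F (0, 0) (1, 0) (1, 1)
  have k₁ : F.comp (edge (0, 0) (0, 1)) = f₀.comp τ := by
    ext t
    have : (edge (0, 0) (0, 1) : SingularSimplex 1 (ℝ × ℝ)) t = (0, edge 0 1 t) := by
      simp [edge_apply]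
    simp only [ContinuousMap.comp_apply, this, F, ContinuousMap.coe_mk, lineToSimplex_edge, h₀]
  have k₂ : F.comp (edge (1, 0) (1, 1)) = f₁.comp τ := by
    ext t
    have : (edge (1, 0) (1, 1) : SingularSimplex 1 (ℝ × ℝ)) t = (1, edge 0 1 t) := by
      simp [edge_apply, stdSimplex.add_eq_one]
    simp only [ContinuousMap.comp_apply, this, F, ContinuousMap.coe_mk, lineToSimplex_edge, h₁]
  have k₃ : F.comp (edge (0, 0) (1, 0)) = (S (τ (stdSimplex.vertex 0))).comp (edge 0 1) := by
    ext t
    have : (edge (0, 0) (1, 0) : SingularSimplex 1 (ℝ × ℝ)) t = (edge 0 1 t, 0) := by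
      simp [edge_apply]
    simp only [ContinuousMap.comp_apply, this, F, S, ContinuousMap.coe_mk, lineToSimplex_zero]
  have k₄ : F.comp (edge (0, 1) (1, 1)) = (S (τ (stdSimplex.vertex 1))).comp (edge 0 1) := by
    ext t
    have : (edge (0, 1) (1, 1) : SingularSimplex 1 (ℝ × ℝ)) t = (edge 0 1 t, 1) := by
      simp [edge_apply, stdSimplex.add_eq_one]
    simp only [ContinuousMap.comp_apply, this, F, S, ContinuousMap.coe_mk, lineToSimplex_one]
  rw [k₁, k₄] at e₁
  rw [k₃, k₂] at e₂
  rw [← CharTwo.sub_eq_add (c _)]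
  linear_combination e₁ - e₂

/-- A `1`-cocycle vanishing on every simplex small of the order of an open cover vanishes. -/
theorem cocycle_eq_zero_of_openCover {ι : Type*} {c : Cochain 1 X} (hc : c ∈ cocycles 1 X)
    (U : ι → Set X) (hU : ∀ i, IsOpen (U i)) (hcov : ∀ x, ∃ i, x ∈ U i)
    (h : ∀ i (σ : SingularSimplex 1 X), (∀ t, σ t ∈ U i) → c σ = 0) : c = 0 := by
  ext σ
  let F : C(ℝ, X) := σ.comp lineToSimplex
  obtain ⟨t, ht0, htm, ⟨n, hn⟩, ht⟩ := exists_monotone_Icc_subset_open_cover_unitInterval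
    (c := fun i => {r : unitInterval | F r ∈ U i})
    (fun i => (hU i).preimage (F.continuous.comp continuous_subtype_val))
    (fun r _ => by simpa using hcov (F r))
  have key : ∀ m, c (F.comp (edge (0 : ℝ) (t m))) = 0 := by
    intro m
    induction m with
    | zero => rw [ht0]; exact cocycle_edge_self hc F 0
    | succ m ih =>
      rw [← cocycle_edge_add hc F 0 (t m : ℝ) (t (m + 1)), ih, zero_add]
      obtain ⟨i, hi⟩ := ht m
      refine h i _ fun r => ?_
      have hle : (t m : ℝ) ≤ t (m + 1) := htm (Nat.le_succ m)
      have hr : edge (t m : ℝ) (t (m + 1)) r ∈ Set.Icc (t m : ℝ) (t (m + 1)) := by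
        rw [edge_apply]
        exact (convex_Icc _ _) (Set.left_mem_Icc.2 hle) (Set.right_mem_Icc.2 hle)
          (stdSimplex.zero_le r 0) (stdSimplex.zero_le r 1) (stdSimplex.add_eq_one r)
      have hr' : edge (t m : ℝ) (t (m + 1)) r ∈ unitInterval :=
        ⟨(t m).2.1.trans hr.1, hr.2.trans (t (m + 1)).2.2⟩
      exact hi (a := ⟨_, hr'⟩) ⟨hr.1, hr.2⟩
  have := key n
  rw [hn n le_rfl] at this
  rw [← comp_lineToSimplex_edge σ]
  exact this

end Cochains

/-! ### Homogeneous coordinates and continuity on projective space -/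

section ProjectiveSpace

variable {s n m : ℕ}

/-- The vector `v` is a system of homogeneous coordinates of the point `p`; in particular
`v ≠ 0`. -/
def Represents (v : Fin (s + 1) → ℝ) (p : RealProjectiveSpace s) : Prop :=
  ∃ hv : v ≠ 0, RealProjectiveSpace.mk v hv = p

theorem exists_represents (p : RealProjectiveSpace s) : ∃ v, Represents v p :=
  ⟨Projectivization.rep p, Projectivization.rep_nonzero p, Projectivization.mk_rep p⟩

theorem represents_mk {v : Fin (s + 1) → ℝ} (hv : v ≠ 0) :
    Represents v (RealProjectiveSpace.mk v hv) := ⟨hv, rfl⟩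

theorem Represents.ne_zero {v : Fin (s + 1) → ℝ} {p : RealProjectiveSpace s}
    (h : Represents v p) : v ≠ 0 := h.1

theorem Represents.unique {v : Fin (s + 1) → ℝ} {p q : RealProjectiveSpace s}
    (h : Represents v p) (h' : Represents v q) : p = q := h.2.symm.trans h'.2

theorem Represents.smul {v : Fin (s + 1) → ℝ} {p : RealProjectiveSpace s}
    (h : Represents v p) {r : ℝ} (hr : r ≠ 0) : Represents (r • v) p := by
  obtain ⟨hv, rfl⟩ := h
  exact ⟨smul_ne_zero hr hv, (Projectivization.mk_eq_mk_iff' ℝ _ _ _ _).2 ⟨r, rfl⟩⟩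

theorem Represents.exists_smul {v w : Fin (s + 1) → ℝ} {p : RealProjectiveSpace s}
    (h : Represents v p) (h' : Represents w p) : ∃ r : ℝ, r ≠ 0 ∧ w = r • v := by
  obtain ⟨hv, rfl⟩ := h
  obtain ⟨hw, h'⟩ := h'
  obtain ⟨r, hr⟩ := (Projectivization.mk_eq_mk_iff' ℝ _ _ _ _).1 h'
  refine ⟨r, ?_, hr.symm⟩
  rintro rfl
  exact hw (by rw [← hr, zero_smul])

theorem dotProduct_self_pos {ι : Type*} [Fintype ι] {v : ι → ℝ} (hv : v ≠ 0) : 0 < v ⬝ᵥ v :=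
  lt_of_le_of_ne (Finset.sum_nonneg fun i _ => mul_self_nonneg (v i))
    fun h => hv (dotProduct_self_eq_zero.1 h.symm)

theorem continuous_mk {Z : Type*} [TopologicalSpace Z] {f : Z → Fin (s + 1) → ℝ}
    (hf : Continuous f) (h : ∀ z, f z ≠ 0) :
    Continuous fun z => RealProjectiveSpace.mk (f z) (h z) := by
  have h₁ : Continuous fun z => (⟨f z, h z⟩ : {v : Fin (s + 1) → ℝ // v ≠ 0}) :=
    hf.subtype_mk h
  exact continuous_coinduced_rng.comp h₁

/-- The entry `xᵢ xⱼ / |x|²` of the orthogonal projection onto the line `[x]`. -/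
def entry (i j : Fin (s + 1)) : C(RealProjectiveSpace s, ℝ) where
  toFun p := Projectivization.lift
    (fun v : {v : Fin (s + 1) → ℝ // v ≠ 0} => v.1 i * v.1 j / (v.1 ⬝ᵥ v.1))
    (by
      rintro ⟨a, ha⟩ ⟨b, hb⟩ t (rfl : a = t • b)
      have ht : t ≠ 0 := by rintro rfl; simp at ha
      have := (dotProduct_self_pos hb).ne'
      simp only [smul_dotProduct, dotProduct_smul, Pi.smul_apply, smul_eq_mul]
      field_simp) p
  continuous_toFun := by
    refine continuous_coinduced_dom.2 ?_
    change Continuous fun v : {v : Fin (s + 1) → ℝ // v ≠ 0} => v.1 i * v.1 j / (v.1 ⬝ᵥ v.1)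
    have hc (k : Fin (s + 1)) : Continuous fun v : {v : Fin (s + 1) → ℝ // v ≠ 0} => v.1 k :=
      (continuous_apply k).comp continuous_subtype_val
    exact ((hc i).mul (hc j)).div (continuous_finsetSum _ fun k _ => (hc k).mul (hc k))
      fun v => (dotProduct_self_pos v.2).ne'

theorem Represents.entry_eq {v : Fin (s + 1) → ℝ} {p : RealProjectiveSpace s}
    (h : Represents v p) (i j : Fin (s + 1)) : entry i j p = v i * v j / (v ⬝ᵥ v) := by
  obtain ⟨hv, rfl⟩ := h
  rfl

theorem entry_mul_pos_iff {v w : Fin (s + 1) → ℝ} {p q : RealProjectiveSpace s}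
    (hv : Represents v p) (hw : Represents w q) (i j : Fin (s + 1)) :
    0 < entry i j p * entry i j q ↔ 0 < v i * v j * (w i * w j) := by
  have h₁ := dotProduct_self_pos hv.ne_zero
  have h₂ := dotProduct_self_pos hw.ne_zero
  rw [hv.entry_eq, hw.entry_eq, div_mul_div_comm]
  exact div_pos_iff_of_pos_right (mul_pos h₁ h₂)

theorem Represents.entry_ne_zero_iff {v : Fin (s + 1) → ℝ} {p : RealProjectiveSpace s}
    (h : Represents v p) (i j : Fin (s + 1)) : entry i j p ≠ 0 ↔ v i ≠ 0 ∧ v j ≠ 0 := by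
  rw [h.entry_eq, div_ne_zero_iff, mul_ne_zero_iff]
  exact and_iff_left (dotProduct_self_pos h.ne_zero).ne'

theorem exists_entry_self_ne_zero (p : RealProjectiveSpace s) : ∃ k, entry k k p ≠ 0 := by
  obtain ⟨v, hv⟩ := exists_represents p
  obtain ⟨k, hk⟩ := Function.ne_iff.1 hv.ne_zero
  exact ⟨k, (hv.entry_ne_zero_iff k k).2 ⟨hk, hk⟩⟩

theorem represents_column {p : RealProjectiveSpace s} {k : Fin (s + 1)} (h : entry k k p ≠ 0) :
    Represents (fun i => entry i k p) p := by
  obtain ⟨v, hv⟩ := exists_represents p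
  have hk := ((hv.entry_ne_zero_iff k k).1 h).1
  convert hv.smul (div_ne_zero hk (dotProduct_self_pos hv.ne_zero).ne') using 1
  ext i
  rw [hv.entry_eq, Pi.smul_apply, smul_eq_mul]
  ring

/-- The homogeneous coordinates of `p` normalized to have `i`-th coordinate `1`. -/
def normalized (i : Fin (s + 1)) (p : RealProjectiveSpace s) : Fin (s + 1) → ℝ :=
  fun j => entry j i p / entry i i p

theorem normalized_self {i : Fin (s + 1)} {p : RealProjectiveSpace s} (h : entry i i p ≠ 0) :
    normalized i p i = 1 := div_self h

theorem represents_normalized {i : Fin (s + 1)} {p : RealProjectiveSpace s}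
    (h : entry i i p ≠ 0) : Represents (normalized i p) p := by
  convert (represents_column h).smul (inv_ne_zero h) using 1
  ext j
  rw [normalized, Pi.smul_apply, smul_eq_mul, div_eq_inv_mul]

/-- A continuous family of linear maps, injective on the lines `φ z`, acts on these lines. The
definition uses a chosen vector on each line; `represents_projMap` shows that any other will do. -/
def projMap {Z : Type*} [TopologicalSpace Z] (φ : C(Z, RealProjectiveSpace n))
    (T : Z → (Fin (n + 1) → ℝ) →ₗ[ℝ] (Fin (m + 1) → ℝ))
    (hT : Continuous fun q : Z × (Fin (n + 1) → ℝ) => T q.1 q.2)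
    (h : ∀ z v, Represents v (φ z) → T z v ≠ 0) : C(Z, RealProjectiveSpace m) where
  toFun z := RealProjectiveSpace.mk (T z (exists_represents (φ z)).choose)
    (h z _ (exists_represents (φ z)).choose_spec)
  continuous_toFun := by
    refine continuous_iff_continuousAt.2 fun z₀ => ?_
    obtain ⟨k, hk⟩ := exists_entry_self_ne_zero (φ z₀)
    let W : Set Z := {z | entry k k (φ z) ≠ 0}
    have hW : IsOpen W := isOpen_ne.preimage ((entry k k).continuous.comp φ.continuous)
    -- near `z₀` the lines are spanned by the continuous field of `k`-th columns
    refine (ContinuousOn.continuousAt ?_ (hW.mem_nhds hk))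
    rw [continuousOn_iff_continuous_domRestrict]
    have hc : Continuous fun z : W => T z (fun i => entry i k (φ z)) := by
      refine hT.comp (Continuous.prodMk continuous_subtype_val (continuous_pi fun i => ?_))
      exact (entry i k).continuous.comp (φ.continuous.comp continuous_subtype_val)
    convert continuous_mk hc fun z => h z _ (represents_column z.2) using 1
    ext z
    obtain ⟨r, hr, hv⟩ := (represents_column z.2).exists_smul
      (exists_represents (φ z)).choose_spec
    refine (Projectivization.mk_eq_mk_iff' ℝ _ _ _ _).2 ⟨r, ?_⟩
    rw [hv, map_smul]

theorem represents_projMap {Z : Type*} [TopologicalSpace Z] (φ : C(Z, RealProjectiveSpace n))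
    (T : Z → (Fin (n + 1) → ℝ) →ₗ[ℝ] (Fin (m + 1) → ℝ))
    (hT : Continuous fun q : Z × (Fin (n + 1) → ℝ) => T q.1 q.2)
    (h : ∀ z v, Represents v (φ z) → T z v ≠ 0) {z : Z} {v : Fin (n + 1) → ℝ}
    (hv : Represents v (φ z)) {w : Fin (m + 1) → ℝ} (hw : w = T z v) :
    Represents w (projMap φ T hT h z) := by
  rw [hw]
  obtain ⟨r, hr, e⟩ := (exists_represents (φ z)).choose_spec.exists_smul hv
  rw [e, map_smul]
  exact (represents_mk (h z _ (exists_represents (φ z)).choose_spec)).smul hr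

end ProjectiveSpace

/-! ### Lifting simplices from projective space to nonzero vectors -/

section Lifting

variable {s : ℕ} {Z : Type*} [TopologicalSpace Z]

/-- `f` is a lift of `φ` along the tautological map `ℝ^{s+1} ∖ {0} → ℝP^s`. -/
def IsLift (f : C(Z, Fin (s + 1) → ℝ)) (φ : C(Z, RealProjectiveSpace s)) : Prop :=
  ∀ z, Represents (f z) (φ z)

/-- The squared cosine of the angle between two lines. -/
def overlap (s : ℕ) : C(RealProjectiveSpace s × RealProjectiveSpace s, ℝ) where
  toFun p := ∑ i, ∑ j, entry i j p.1 * entry i j p.2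

theorem overlap_eq {v w : Fin (s + 1) → ℝ} {p q : RealProjectiveSpace s}
    (hv : Represents v p) (hw : Represents w q) :
    overlap s (p, q) = (v ⬝ᵥ w) ^ 2 / ((v ⬝ᵥ v) * (w ⬝ᵥ w)) := by
  change ∑ i, ∑ j, entry i j p * entry i j q = _
  rw [sq, dotProduct, Finset.sum_mul_sum, Finset.sum_div]
  refine Finset.sum_congr rfl fun i _ => ?_
  rw [Finset.sum_div]
  refine Finset.sum_congr rfl fun j _ => ?_
  rw [hv.entry_eq, hw.entry_eq, div_mul_div_comm]
  congr 1
  ring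

theorem overlap_self (p : RealProjectiveSpace s) : overlap s (p, p) = 1 := by
  obtain ⟨v, hv⟩ := exists_represents p
  have := (dotProduct_self_pos hv.ne_zero).ne'
  rw [overlap_eq hv hv]
  field_simp

/-- Lifts can be carried by orthogonal projection to a pointwise nonorthogonal family of lines. -/
theorem IsLift.exists_of_overlap {f : C(Z, Fin (s + 1) → ℝ)} {φ ψ : C(Z, RealProjectiveSpace s)}
    (hf : IsLift f φ) (h : ∀ z, overlap s (φ z, ψ z) ≠ 0) :
    ∃ g : C(Z, Fin (s + 1) → ℝ), IsLift g ψ := by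
  refine ⟨⟨fun z i => ∑ j, entry i j (ψ z) * f z j, by fun_prop⟩, fun z => ?_⟩
  obtain ⟨w, hw⟩ := exists_represents (ψ z)
  have h₁ : f z ⬝ᵥ w ≠ 0 := by
    intro h₀
    apply h z
    rw [overlap_eq (hf z) hw, h₀]
    simp
  convert hw.smul (div_ne_zero h₁ (dotProduct_self_pos hw.ne_zero).ne') using 1
  ext i
  change ∑ j, entry i j (ψ z) * f z j = _
  simp only [hw.entry_eq, Pi.smul_apply, smul_eq_mul]
  rw [show f z ⬝ᵥ w = ∑ j, f z j * w j from rfl, Finset.sum_div, Finset.sum_mul]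
  refine Finset.sum_congr rfl fun j _ => ?_
  ring

/-- Homotopy lifting: a homotopy is cut into steps so small that corresponding lines of
consecutive stages are never orthogonal. -/
theorem exists_lift_of_homotopy {Z : Type*} [PseudoMetricSpace Z] [CompactSpace Z]
    {φ ψ : C(Z, RealProjectiveSpace s)} (H : φ.Homotopy ψ)
    {f : C(Z, Fin (s + 1) → ℝ)} (hf : IsLift f φ) :
    ∃ g : C(Z, Fin (s + 1) → ℝ), IsLift g ψ := by
  let D : (unitInterval × unitInterval) × Z → ℝ := fun a =>
    overlap s (H (a.1.1, a.2), H (a.1.2, a.2))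
  have hD : Continuous D := by fun_prop
  obtain ⟨δ, hδ, hu⟩ := Metric.uniformContinuous_iff.1
    (CompactSpace.uniformContinuous_of_continuous hD) 1 one_pos
  have hne : ∀ (t t' : unitInterval) (z : Z), dist t t' < δ →
      overlap s (H (t, z), H (t', z)) ≠ 0 := by
    intro t t' z htt h₀
    have := @hu ((t, t), z) ((t, t'), z) (by simp [Prod.dist_eq, htt])
    simp only [D, overlap_self, h₀] at this
    norm_num at this
  let t (k : ℕ) : unitInterval := Set.projIcc 0 1 zero_le_one (k * (δ / 2))
  have ht : ∀ k, dist (t k) (t (k + 1)) < δ := by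
    intro k
    have := (LipschitzWith.projIcc (zero_le_one : (0 : ℝ) ≤ 1)).dist_le_mul
      (k * (δ / 2)) ((k + 1 : ℕ) * (δ / 2))
    refine lt_of_le_of_lt this ?_
    rw [Real.dist_eq, show (k : ℝ) * (δ / 2) - (k + 1 : ℕ) * (δ / 2) = -(δ / 2) by push_cast; ring,
      abs_neg, abs_of_pos (half_pos hδ)]
    simp [hδ]
  have key : ∀ k, ∃ g : C(Z, Fin (s + 1) → ℝ), IsLift g (H.toContinuousMap.comp
      ⟨fun z => (t k, z), by fun_prop⟩) := by
    intro k
    induction k with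
    | zero =>
      refine ⟨f, fun z => ?_⟩
      have h0 : t 0 = 0 := by
        change Set.projIcc 0 1 zero_le_one (((0 : ℕ) : ℝ) * (δ / 2)) = 0
        rw [Nat.cast_zero, zero_mul]
        exact Set.projIcc_left zero_le_one
      change Represents (f z) (H (t 0, z))
      rw [h0, H.apply_zero]
      exact hf z
    | succ k ih =>
      obtain ⟨g, hg⟩ := ih
      exact hg.exists_of_overlap fun z => hne _ _ z (ht k)
  obtain ⟨k, hk⟩ := exists_nat_ge (1 / (δ / 2))
  obtain ⟨g, hg⟩ := key k
  refine ⟨g, fun z => ?_⟩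
  have h1 : t k = 1 :=
    Set.projIcc_of_right_le zero_le_one ((div_le_iff₀ (half_pos hδ)).1 hk)
  have := hg z
  change Represents (g z) (H (t k, z)) at this
  rwa [h1, H.apply_one] at this

theorem exists_isLift {Z : Type*} [PseudoMetricSpace Z] [CompactSpace Z] [ContractibleSpace Z]
    (φ : C(Z, RealProjectiveSpace s)) : ∃ f : C(Z, Fin (s + 1) → ℝ), IsLift f φ := by
  obtain ⟨z₀, ⟨H⟩⟩ := id_nullhomotopic Z
  obtain ⟨v, hv⟩ := exists_represents (φ z₀)
  have hf : IsLift (ContinuousMap.const Z v) (φ.comp (ContinuousMap.const Z z₀)) := fun _ => hv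
  exact exists_lift_of_homotopy ((ContinuousMap.Homotopy.refl φ).comp H.symm) hf

instance contractibleSpace_stdSimplex (n : ℕ) :
    ContractibleSpace (stdSimplex ℝ (Fin (n + 1))) :=
  (convex_stdSimplex ℝ (Fin (n + 1))).contractibleSpace
    ⟨_, single_mem_stdSimplex ℝ (0 : Fin (n + 1))⟩

end Lifting

/-! ### The tautological cocycle -/

section Generator

variable {s n m : ℕ}

/-- The sign of a nonzero real number, written additively in `ℤ/2`. -/
def signBit (r : ℝ) : ZMod 2 := if r < 0 then 1 else 0

theorem signBit_of_pos {r : ℝ} (hr : 0 < r) : signBit r = 0 := if_neg hr.not_gt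

theorem signBit_of_neg {r : ℝ} (hr : r < 0) : signBit r = 1 := if_pos hr

theorem signBit_mul {a b : ℝ} (ha : a ≠ 0) (hb : b ≠ 0) :
    signBit (a * b) = signBit a + signBit b := by
  rcases ha.lt_or_gt with ha | ha <;> rcases hb.lt_or_gt with hb | hb
  · rw [signBit_of_pos (mul_pos_of_neg_of_neg ha hb), signBit_of_neg ha, signBit_of_neg hb]
    decide
  · rw [signBit_of_neg (mul_neg_of_neg_of_pos ha hb), signBit_of_neg ha, signBit_of_pos hb]
    decide
  · rw [signBit_of_neg (mul_neg_of_pos_of_neg ha hb), signBit_of_pos ha, signBit_of_neg hb]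
    decide
  · rw [signBit_of_pos (mul_pos ha hb), signBit_of_pos ha, signBit_of_pos hb]
    decide

/-- Which of the two rays of its line a nonzero vector spans, relative to an arbitrary
(discontinuous) choice of a ray on every line. -/
def rayBit (v : Fin (s + 1) → ℝ) : ZMod 2 :=
  if h : v ≠ 0 then signBit (v ⬝ᵥ (exists_represents (RealProjectiveSpace.mk v h)).choose) else 0

theorem rayBit_add_rayBit {v w : Fin (s + 1) → ℝ} {p : RealProjectiveSpace s}
    (hv : Represents v p) (hw : Represents w p) : rayBit v + rayBit w = signBit (v ⬝ᵥ w) := by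
  have key : ∀ u, Represents u p → rayBit u = signBit (u ⬝ᵥ (exists_represents p).choose) := by
    rintro u ⟨hu, rfl⟩
    exact dif_pos hu
  rw [key v hv, key w hw]
  have hr := (exists_represents p).choose_spec
  generalize (exists_represents p).choose = r at hr
  obtain ⟨a, ha, rfl⟩ := hr.exists_smul hv
  obtain ⟨b, hb, rfl⟩ := hr.exists_smul hw
  have hd := dotProduct_self_pos hr.ne_zero
  simp only [smul_dotProduct, dotProduct_smul, smul_eq_mul]
  rw [signBit_mul ha hd.ne', signBit_mul hb hd.ne', signBit_mul hb (mul_ne_zero ha hd.ne'),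
    signBit_mul ha hd.ne', signBit_of_pos hd]
  ring

theorem rayBit_smul {v : Fin (s + 1) → ℝ} (hv : v ≠ 0) {a : ℝ} (ha : a ≠ 0) :
    rayBit (a • v) = signBit a + rayBit v := by
  have hd := dotProduct_self_pos hv
  have h := rayBit_add_rayBit ((represents_mk hv).smul ha) (represents_mk hv)
  rw [smul_dotProduct, smul_eq_mul, signBit_mul ha hd.ne', signBit_of_pos hd, add_zero] at h
  rw [← h, add_assoc, CharTwo.add_self_eq_zero, add_zero]

theorem IsLift.rayBit_add_rayBit_eq {Z : Type*} [TopologicalSpace Z] [PreconnectedSpace Z]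
    {φ : C(Z, RealProjectiveSpace s)} {f g : C(Z, Fin (s + 1) → ℝ)} (hf : IsLift f φ)
    (hg : IsLift g φ) (y z : Z) :
    rayBit (f y) + rayBit (g y) = rayBit (f z) + rayBit (g z) := by
  rw [rayBit_add_rayBit (hf y) (hg y), rayBit_add_rayBit (hf z) (hg z)]
  let d : Z → ℝ := fun z => f z ⬝ᵥ g z
  have hd : Continuous d := by
    refine continuous_finsetSum _ fun i _ => ?_
    fun_prop
  have h0 : ∀ z, d z ≠ 0 := by
    intro z
    obtain ⟨a, ha, h⟩ := (hf z).exists_smul (hg z)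
    simp only [d, h, dotProduct_smul, smul_eq_mul]
    exact mul_ne_zero ha (dotProduct_self_pos (hf z).ne_zero).ne'
  have hno : ∀ y z, d y < 0 → ¬ 0 < d z := by
    intro y z hy hz
    obtain ⟨x, hx⟩ := mem_range_of_exists_le_of_exists_ge hd ⟨y, hy.le⟩ ⟨z, hz.le⟩
    exact h0 x hx
  change signBit (d y) = signBit (d z)
  rcases (h0 y).lt_or_gt with hy | hy <;> rcases (h0 z).lt_or_gt with hz | hz
  · rw [signBit_of_neg hy, signBit_of_neg hz]
  · exact (hno y z hy hz).elim
  · exact (hno z y hz hy).elim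
  · rw [signBit_of_pos hy, signBit_of_pos hz]

/-- The first Stiefel–Whitney cochain of the tautological line bundle of `ℝP^s`: it records whether
continuous transport along a path matches the chosen rays at its endpoints. -/
def tautCochain (s : ℕ) : Cochain 1 (RealProjectiveSpace s) := fun σ =>
  rayBit ((exists_isLift σ).choose (stdSimplex.vertex 0)) +
    rayBit ((exists_isLift σ).choose (stdSimplex.vertex 1))

theorem IsLift.tautCochain_eq {σ : SingularSimplex 1 (RealProjectiveSpace s)}
    {f : C(stdSimplex ℝ (Fin 2), Fin (s + 1) → ℝ)} (hf : IsLift f σ) :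
    tautCochain s σ = rayBit (f (stdSimplex.vertex 0)) + rayBit (f (stdSimplex.vertex 1)) := by
  have h := hf.rayBit_add_rayBit_eq (exists_isLift σ).choose_spec
    (stdSimplex.vertex 0) (stdSimplex.vertex 1)
  unfold tautCochain
  generalize rayBit (f (stdSimplex.vertex 0)) = a at *
  generalize rayBit (f (stdSimplex.vertex 1)) = b at *
  generalize rayBit ((exists_isLift σ).choose (stdSimplex.vertex 0)) = c at *
  generalize rayBit ((exists_isLift σ).choose (stdSimplex.vertex 1)) = d at *
  revert a b c d
  decide

theorem tautCochain_mem_cocycles (s : ℕ) :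
    tautCochain s ∈ cocycles 1 (RealProjectiveSpace s) := by
  change coboundary 1 _ (tautCochain s) = 0
  ext τ
  obtain ⟨f, hf⟩ := exists_isLift τ
  have key : ∀ i : Fin 3, tautCochain s (τ.comp (faceInclusion 1 i)) =
      rayBit (f (stdSimplex.vertex (i.succAbove 0))) +
        rayBit (f (stdSimplex.vertex (i.succAbove 1))) := by
    intro i
    have hl : IsLift (f.comp (faceInclusion 1 i)) (τ.comp (faceInclusion 1 i)) := fun z => hf _
    rw [hl.tautCochain_eq]
    simp only [ContinuousMap.comp_apply, faceInclusion, ContinuousMap.coe_mk,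
      stdSimplex.map_vertex]
  change ∑ i : Fin 3, tautCochain s (τ.comp (faceInclusion 1 i)) = 0
  rw [Fin.sum_univ_three, key, key, key]
  change rayBit (f (stdSimplex.vertex 1)) + rayBit (f (stdSimplex.vertex 2)) +
    (rayBit (f (stdSimplex.vertex 0)) + rayBit (f (stdSimplex.vertex 2))) +
    (rayBit (f (stdSimplex.vertex 0)) + rayBit (f (stdSimplex.vertex 1))) = 0
  generalize rayBit (f (stdSimplex.vertex 0)) = a
  generalize rayBit (f (stdSimplex.vertex 1)) = b
  generalize rayBit (f (stdSimplex.vertex 2)) = c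
  revert a b c
  decide

/-- The tautological class is natural for maps of projective spaces induced by linear maps. -/
theorem cochainMap_tautCochain_sub_mem_coboundaries
    (L : (Fin (n + 1) → ℝ) →ₗ[ℝ] (Fin (m + 1) → ℝ))
    (l : C(RealProjectiveSpace n, RealProjectiveSpace m))
    (h : ∀ v p, Represents v p → Represents (L v) (l p)) :
    cochainMap 1 l (tautCochain m) - tautCochain n ∈ coboundaries 1 (RealProjectiveSpace n) := by
  rw [mem_coboundaries_one_iff]
  let g (p : RealProjectiveSpace n) : ZMod 2 :=
    rayBit (L (exists_represents p).choose) - rayBit (exists_represents p).choose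
  have hg : ∀ v p, Represents v p → g p = rayBit (L v) - rayBit v := by
    intro v p hv
    have hr := (exists_represents p).choose_spec
    obtain ⟨a, ha, e⟩ := hr.exists_smul hv
    rw [e, map_smul, rayBit_smul (h _ _ hr).ne_zero ha, rayBit_smul hr.ne_zero ha]
    simp only [g]
    ring
  refine ⟨g, fun σ => ?_⟩
  obtain ⟨f, hf⟩ := exists_isLift σ
  have hLf : IsLift (⟨fun z => L (f z), L.continuous_of_finiteDimensional.comp f.continuous⟩ :
      C(stdSimplex ℝ (Fin 2), Fin (m + 1) → ℝ)) (l.comp σ) := fun z => h _ _ (hf z)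
  change tautCochain m (l.comp σ) - tautCochain n σ = _
  rw [hLf.tautCochain_eq, hf.tautCochain_eq, hg _ _ (hf _), hg _ _ (hf _)]
  simp only [ContinuousMap.coe_mk]
  ring

/-- A projective line in `ℝP^s` is a loop on which the tautological cocycle does not vanish. -/
theorem tautCochain_notMem_coboundaries (hs : 1 ≤ s) :
    tautCochain s ∉ coboundaries 1 (RealProjectiveSpace s) := by
  intro h
  obtain ⟨g, hg⟩ := mem_coboundaries_one_iff.1 h
  obtain ⟨k, rfl⟩ : ∃ k, s = k + 1 := ⟨s - 1, by omega⟩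
  -- a path of nonzero vectors in the plane of `e₀` and `e₁`, from `e₀` to `-e₀`
  let f : C(stdSimplex ℝ (Fin 2), Fin (k + 1 + 1) → ℝ) :=
    ⟨fun t => Pi.single 0 (t 0 - t 1) + Pi.single 1 (t 0 * t 1), by
      have h₀ : Continuous fun t : stdSimplex ℝ (Fin 2) => t 0 :=
        (continuous_apply 0).comp continuous_subtype_val
      have h₁ : Continuous fun t : stdSimplex ℝ (Fin 2) => t 1 :=
        (continuous_apply 1).comp continuous_subtype_val
      have h₂ : Continuous fun t : stdSimplex ℝ (Fin 2) => t 0 * t 1 := h₀.mul h₁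
      refine continuous_pi fun i => ?_
      simp only [Pi.add_apply, Pi.single_apply]
      split_ifs
      exacts [(h₀.sub h₁).add h₂, (h₀.sub h₁).add continuous_const, continuous_const.add h₂,
        continuous_const]⟩
  have hne : ∀ t, f t ≠ 0 := by
    intro t ht
    have e₀ : t 0 - t 1 = 0 := by simpa [f] using congrFun ht 0
    have e₁ : t 0 * t 1 = 0 := by simpa [f] using congrFun ht 1
    have e₂ := stdSimplex.add_eq_one t
    nlinarith
  let σ : SingularSimplex 1 (RealProjectiveSpace (k + 1)) :=
    ⟨fun t => RealProjectiveSpace.mk (f t) (hne t), continuous_mk f.continuous hne⟩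
  have hf : IsLift f σ := fun t => represents_mk (hne t)
  have e : f (stdSimplex.vertex 1) = (-1 : ℝ) • f (stdSimplex.vertex 0) := by
    simp [f, ← Pi.single_neg]
  have hσ : σ (stdSimplex.vertex 1) = σ (stdSimplex.vertex 0) := by
    refine (hf (stdSimplex.vertex 1)).unique ?_
    rw [e]
    exact (hf _).smul (by norm_num)
  have := hg σ
  rw [hf.tautCochain_eq, hσ, e, rayBit_smul (hne _) (by norm_num), signBit_of_neg (by norm_num),
    CharTwo.add_self_eq_zero] at this
  generalize rayBit (f (stdSimplex.vertex 0)) = a at this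
  revert a
  decide

end Generator

/-! ### Cocycles that are trivial over the affine charts -/

section Gluing

variable {s : ℕ} {X E : Type*} [TopologicalSpace X] [TopologicalSpace E]

/-- The inclusion of a subspace. -/
def incl (S : Set X) : C(S, X) := ⟨Subtype.val, continuous_subtype_val⟩

theorem exists_of_restrict_mem_coboundaries {S : Set X} {c : Cochain 1 X}
    (h : cochainMap 1 (incl S) c ∈ coboundaries 1 S) :
    ∃ g : X → ZMod 2, ∀ σ : SingularSimplex 1 X, (∀ t, σ t ∈ S) →
      c σ = g (σ (stdSimplex.vertex 0)) + g (σ (stdSimplex.vertex 1)) := by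
  classical
  obtain ⟨g, hg⟩ := mem_coboundaries_one_iff.1 h
  refine ⟨fun x => if hx : x ∈ S then g ⟨x, hx⟩ else 0, fun σ hσ => ?_⟩
  simp only [dif_pos (hσ _)]
  exact hg ⟨fun t => ⟨σ t, hσ t⟩, σ.continuous.subtype_mk hσ⟩

theorem rayBit_normalized_add {i j : Fin (s + 1)} {p : RealProjectiveSpace s}
    (h : entry i j p ≠ 0) :
    rayBit (normalized i p) + rayBit (normalized j p) = signBit (entry i j p) := by
  obtain ⟨v, hv⟩ := exists_represents p
  obtain ⟨hi, hj⟩ := (hv.entry_ne_zero_iff i j).1 h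
  have hii := (hv.entry_ne_zero_iff i i).2 ⟨hi, hi⟩
  have hjj := (hv.entry_ne_zero_iff j j).2 ⟨hj, hj⟩
  have hd := dotProduct_self_pos hv.ne_zero
  have key : ∀ k, v k ≠ 0 → normalized k p = (v k)⁻¹ • v := by
    intro k hk
    ext l
    rw [normalized, hv.entry_eq, hv.entry_eq, Pi.smul_apply, smul_eq_mul]
    have := hd.ne'
    field_simp
  rw [key i hi, key j hj, rayBit_smul hv.ne_zero (inv_ne_zero hi),
    rayBit_smul hv.ne_zero (inv_ne_zero hj), hv.entry_eq, div_eq_mul_inv,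
    signBit_mul (mul_ne_zero hi hj) (inv_ne_zero hd.ne'), signBit_mul hi hj,
    signBit_of_pos (inv_pos.2 hd)]
  have hinv : ∀ r : ℝ, signBit r⁻¹ = signBit r := by
    intro r
    simp only [signBit, inv_lt_zero]
  rw [hinv, hinv]
  generalize signBit (v i) = a
  generalize signBit (v j) = b
  generalize rayBit v = c
  revert a b c
  decide

/-- Let `h i z` be such that `h i + h j` is constant on each of the two sign components of the
overlap of the `i`-th and `j`-th affine charts, and zero on the positive one. Then its value on the
negative component does not depend on the pair `i ≠ j`: compare two pairs at a point
with a single negative coordinate. -/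
theorem exists_transition_constant {Z : Type*} (q : Z → RealProjectiveSpace s)
    (hq : Function.Surjective q)
    (h : Fin (s + 1) → Z → ZMod 2)
    (hpos : ∀ i j z, 0 < entry i j (q z) → h i z + h j z = 0)
    (hneg : ∀ i j z z', entry i j (q z) < 0 → entry i j (q z') < 0 →
      h i z + h j z = h i z' + h j z') :
    ∃ e : ZMod 2, ∀ i j z, entry i j (q z) ≠ 0 →
      h i z + h j z = e * signBit (entry i j (q z)) := by
  have hself : ∀ i z, ¬ entry i i (q z) < 0 := by
    intro i z
    obtain ⟨v, hv⟩ := exists_represents (q z)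
    rw [hv.entry_eq, not_lt]
    exact div_nonneg (mul_self_nonneg _) (dotProduct_self_pos hv.ne_zero).le
  let x (k : Fin (s + 1)) : Fin (s + 1) → ℝ := fun j => if j = k then -1 else 1
  have hx : ∀ k, x k ≠ 0 := by
    intro k hk
    have := congrFun hk k
    simp [x] at this
  choose z hz using fun k => hq (RealProjectiveSpace.mk (x k) (hx k))
  have hent : ∀ i j k, entry i j (q (z k)) = x k i * x k j / (x k ⬝ᵥ x k) := by
    intro i j k
    rw [hz]
    exact (represents_mk (hx k)).entry_eq i j
  have hd : ∀ k, 0 < x k ⬝ᵥ x k := fun k => dotProduct_self_pos (hx k)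
  have zneg : ∀ i j, i ≠ j → entry i j (q (z j)) < 0 := by
    intro i j hij
    rw [hent]
    refine div_neg_of_neg_of_pos ?_ (hd j)
    simp [x, hij]
  have zneg' : ∀ i j, i ≠ j → entry j i (q (z j)) < 0 := by
    intro i j hij
    rw [hent]
    refine div_neg_of_neg_of_pos ?_ (hd j)
    simp [x, hij]
  have zpos : ∀ i k j, i ≠ j → k ≠ j → 0 < entry i k (q (z j)) := by
    intro i k j hij hkj
    rw [hent]
    refine div_pos ?_ (hd j)
    simp [x, hij, hkj]
  let M (i j : Fin (s + 1)) : ZMod 2 := h i (z j) + h j (z j)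
  have hM : ∀ i j y, i ≠ j → entry i j (q y) < 0 → h i y + h j y = M i j :=
    fun i j y hij hy => hneg i j y (z j) hy (zneg i j hij)
  have hsymm : ∀ i j, i ≠ j → M i j = M j i := by
    intro i j hij
    rw [← hM j i (z j) hij.symm (zneg' i j hij), add_comm]
  have hshift : ∀ i j k, i ≠ j → k ≠ j → M i j = M k j := by
    intro i j k hij hkj
    have := hpos i k (z j) (zpos i k j hij hkj)
    simp only [M]
    rw [CharTwo.add_eq_zero.1 this]
  have hall : ∀ i j k l, i ≠ j → k ≠ l → M i j = M k l := by
    intro i j k l hij hkl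
    rw [hsymm i j hij]
    by_cases hli : l = i
    · subst hli
      exact hshift j l k hij.symm hkl
    · rw [hshift j i l hij.symm hli, hsymm l i hli, hshift i l k (Ne.symm hli) hkl]
  obtain ⟨e, he⟩ : ∃ e, ∀ i j, i ≠ j → M i j = e := by
    by_cases hex : ∃ p : Fin (s + 1) × Fin (s + 1), p.1 ≠ p.2
    · obtain ⟨p, hp⟩ := hex
      exact ⟨M p.1 p.2, fun i j hij => hall i j p.1 p.2 hij hp⟩
    · exact ⟨0, fun i j hij => (hex ⟨(i, j), hij⟩).elim⟩
  refine ⟨e, fun i j y hy => ?_⟩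
  rcases hy.lt_or_gt with hy | hy
  · have hij : i ≠ j := by
      rintro rfl
      exact hself i y hy
    rw [signBit_of_neg hy, hM i j y hij hy, he i j hij, mul_one]
  · rw [signBit_of_pos hy, hpos i j y hy, mul_zero]

/-- A `1`-cocycle on a space over `ℝP^s` which is a coboundary over each affine chart is, up to a
coboundary, a multiple of the pullback of the tautological cocycle, provided that the
preimages of the two components of every overlap of charts are path connected. -/
theorem exists_sub_smul_tautCochain_mem_coboundaries (q : C(E, RealProjectiveSpace s))
    (hq : Function.Surjective q)
    (hconn : ∀ i j z z', 0 < entry i j (q z) * entry i j (q z') →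
      JoinedIn {y | entry i j (q y) ≠ 0} z z')
    {c : Cochain 1 E} (hc : c ∈ cocycles 1 E)
    (hloc : ∀ i, cochainMap 1 (incl {y | entry i i (q y) ≠ 0}) c ∈ coboundaries 1 _) :
    ∃ e : ZMod 2, c - e • cochainMap 1 q (tautCochain s) ∈ coboundaries 1 E := by
  choose g hg using fun i => exists_of_restrict_mem_coboundaries (hloc i)
  have hsub : ∀ i j p, entry (s := s) i j p ≠ 0 → entry i i p ≠ 0 ∧ entry j j p ≠ 0 := by
    intro i j p hp
    obtain ⟨v, hv⟩ := exists_represents p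
    obtain ⟨hi, hj⟩ := (hv.entry_ne_zero_iff i j).1 hp
    exact ⟨(hv.entry_ne_zero_iff i i).2 ⟨hi, hi⟩, (hv.entry_ne_zero_iff j j).2 ⟨hj, hj⟩⟩
  -- the transition functions are constant along paths in the overlaps
  have htrans : ∀ i j z z', 0 < entry i j (q z) * entry i j (q z') →
      g i z + g j z = g i z' + g j z' := by
    intro i j z z' hzz
    obtain ⟨γ, hγ⟩ := hconn i j z z' hzz
    let σ : SingularSimplex 1 E := ⟨fun t => γ (stdSimplexHomeomorphUnitInterval t), by fun_prop⟩
    have e₀ : σ (stdSimplex.vertex 0) = z := γ.source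
    have e₁ : σ (stdSimplex.vertex 1) = z' := γ.target
    have hi := hg i σ fun t => (hsub i j _ (hγ _)).1
    have hj := hg j σ fun t => (hsub i j _ (hγ _)).2
    rw [e₀, e₁] at hi hj
    rw [hi] at hj
    generalize g i z = a at *
    generalize g j z = b at *
    generalize g i z' = a' at *
    generalize g j z' = b' at *
    clear hi
    revert a b a' b'
    decide
  have hone : (1 : Fin (s + 1) → ℝ) ≠ 0 := one_ne_zero
  obtain ⟨z₀, hz₀⟩ := hq (RealProjectiveSpace.mk 1 hone)
  have hz₀pos : ∀ i j, 0 < entry i j (q z₀) := by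
    intro i j
    rw [hz₀, (represents_mk hone).entry_eq]
    exact div_pos (by simp) (dotProduct_self_pos hone)
  -- normalize the local primitives at a point with all coordinates positive
  let h (i : Fin (s + 1)) (z : E) : ZMod 2 := g i z + g i z₀
  obtain ⟨e, he⟩ := exists_transition_constant q hq h
    (by
      intro i j z hz
      have := htrans i j z z₀ (mul_pos hz (hz₀pos i j))
      simp only [h]
      rw [add_add_add_comm, this, CharTwo.add_self_eq_zero])
    (by
      intro i j z z' hz hz'
      simp only [h]
      rw [add_add_add_comm, htrans i j z z' (mul_pos_of_neg_of_neg hz hz'), add_add_add_comm])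
  choose k hk using fun z => exists_entry_self_ne_zero (q z)
  let w (i : Fin (s + 1)) (z : E) : ZMod 2 := h i z + e * rayBit (normalized i (q z))
  let G (z : E) : ZMod 2 := w (k z) z
  have hG : ∀ i z, entry i i (q z) ≠ 0 → G z = w i z := by
    intro i z hz
    have hne : entry (k z) i (q z) ≠ 0 := by
      obtain ⟨v, hv⟩ := exists_represents (q z)
      exact (hv.entry_ne_zero_iff _ _).2
        ⟨((hv.entry_ne_zero_iff _ _).1 (hk z)).1, ((hv.entry_ne_zero_iff _ _).1 hz).1⟩
    have h₁ := he _ _ z hne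
    have h₂ := rayBit_normalized_add hne
    rw [← CharTwo.add_eq_zero]
    simp only [G, w]
    rw [add_add_add_comm, h₁, ← mul_add, h₂, CharTwo.add_self_eq_zero]
  refine ⟨e, ?_⟩
  let d : Cochain 1 E := fun σ => G (σ (stdSimplex.vertex 0)) + G (σ (stdSimplex.vertex 1))
  have hd : d ∈ coboundaries 1 E := mem_coboundaries_one_iff.2 ⟨G, fun _ => rfl⟩
  have hcoc : c - e • cochainMap 1 q (tautCochain s) - d ∈ cocycles 1 E :=
    sub_mem (sub_mem hc (Submodule.smul_mem _ _
      (cochainMap_mem_cocycles 1 q _ (tautCochain_mem_cocycles s))))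
      (coboundaries_le_cocycles 1 E hd)
  -- over each chart the normalized coordinates are a lift, which evaluates the tautological cocycle
  have hzero := cocycle_eq_zero_of_openCover hcoc (fun i => {y | entry i i (q y) ≠ 0})
    (fun i => isOpen_ne.preimage ((entry i i).continuous.comp q.continuous))
    (fun z => exists_entry_self_ne_zero (q z)) (by
      intro i σ hσ
      have hlift : IsLift (⟨fun t => normalized i (q (σ t)), by
          refine continuous_pi fun j => Continuous.div (by fun_prop) (by fun_prop) hσ⟩ :
          C(stdSimplex ℝ (Fin 2), Fin (s + 1) → ℝ)) (q.comp σ) :=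
        fun t => represents_normalized (hσ t)
      change c σ - e * tautCochain s (q.comp σ) -
        (G (σ (stdSimplex.vertex 0)) + G (σ (stdSimplex.vertex 1))) = 0
      rw [hlift.tautCochain_eq, hG i _ (hσ _), hG i _ (hσ _), hg i σ hσ]
      simp only [w, h, ContinuousMap.coe_mk]
      generalize g i (σ (stdSimplex.vertex 0)) = a
      generalize g i (σ (stdSimplex.vertex 1)) = b
      have h2 : (2 : ZMod 2) = 0 := rfl
      linear_combination (-g i z₀ - e * rayBit (normalized i (q (σ (stdSimplex.vertex 0)))) -
        e * rayBit (normalized i (q (σ (stdSimplex.vertex 1))))) * h2)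
  rw [sub_eq_zero.1 hzero]
  exact hd

end Gluing

/-! ### Contracting the affine charts; the cohomology of projective space -/

section Contraction

variable {s : ℕ} {Z : Type*} [TopologicalSpace Z]

/-- The preimage of the `i`-th affine chart `{xᵢ ≠ 0}` under a map to projective space. -/
abbrev chart (φ : C(Z, RealProjectiveSpace s)) (i : Fin (s + 1)) : Set Z :=
  {z | entry i i (φ z) ≠ 0}

/-- The point at time `t` of the segment in the `i`-th affine chart from `p` to `[w]`. -/
def slideVec (i : Fin (s + 1)) (w : Fin (s + 1) → ℝ) (t : ℝ) (p : RealProjectiveSpace s) :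
    Fin (s + 1) → ℝ :=
  (1 - t) • normalized i p + t • w

variable {i : Fin (s + 1)} {w : Fin (s + 1) → ℝ}

theorem slideVec_self (hw : w i = 1) (t : ℝ) {p : RealProjectiveSpace s}
    (hp : entry i i p ≠ 0) : slideVec i w t p i = 1 := by
  simp [slideVec, normalized_self hp, hw]

theorem slideVec_ne_zero (hw : w i = 1) (t : ℝ) {p : RealProjectiveSpace s}
    (hp : entry i i p ≠ 0) : slideVec i w t p ≠ 0 := by
  intro h
  have := slideVec_self hw t hp
  rw [h] at this
  exact zero_ne_one this

theorem continuous_slideVec (φ : C(Z, RealProjectiveSpace s)) :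
    Continuous fun q : ℝ × chart φ i => slideVec i w q.1 (φ q.2) := by
  have h : Continuous fun z : chart φ i => normalized i (φ z) :=
    continuous_pi fun j => Continuous.div (by fun_prop) (by fun_prop) fun z => z.2
  exact ((continuous_const.sub continuous_fst).smul (h.comp continuous_snd)).add
    (continuous_fst.smul continuous_const)

theorem slideVec_apply_ne_zero {p p' : RealProjectiveSpace s} {j : Fin (s + 1)}
    (hp : entry i i p ≠ 0) (hp' : entry i i p' ≠ 0) (h : 0 < entry i j p * entry i j p')
    {t : ℝ} (ht : t ∈ unitInterval) : slideVec i (normalized i p') t p j ≠ 0 := by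
  rw [entry_mul_pos_iff (represents_normalized hp) (represents_normalized hp'),
    normalized_self hp, normalized_self hp', one_mul, one_mul] at h
  simp only [slideVec, Pi.add_apply, Pi.smul_apply, smul_eq_mul]
  obtain ⟨h0, h1⟩ := ht
  have h1 : 0 ≤ 1 - t := sub_nonneg.2 h1
  rcases pos_and_pos_or_neg_and_neg_of_mul_pos h with ⟨ha, hb⟩ | ⟨ha, hb⟩
  · rcases h0.eq_or_lt with rfl | h0
    · simpa using ha.ne'
    · exact (add_pos_of_nonneg_of_pos (mul_nonneg h1 ha.le) (mul_pos h0 hb)).ne'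
  · rcases h0.eq_or_lt with rfl | h0
    · simpa using ha.ne
    · exact (add_neg_of_nonpos_of_neg (mul_nonpos_of_nonneg_of_nonpos h1 ha.le)
        (mul_neg_of_pos_of_neg h0 hb)).ne

/-- The straight-line homotopy in the `i`-th affine chart towards the point `[w]`. -/
def slideBase (φ : C(Z, RealProjectiveSpace s)) (hw : w i = 1) :
    C(ℝ × chart φ i, RealProjectiveSpace s) :=
  ⟨fun q => RealProjectiveSpace.mk (slideVec i w q.1 (φ q.2)) (slideVec_ne_zero hw q.1 q.2.2),
    continuous_mk (continuous_slideVec φ) _⟩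

theorem represents_slideBase (φ : C(Z, RealProjectiveSpace s)) (hw : w i = 1)
    (q : ℝ × chart φ i) : Represents (slideVec i w q.1 (φ q.2)) (slideBase φ hw q) :=
  represents_mk _

theorem slideBase_zero (φ : C(Z, RealProjectiveSpace s)) (hw : w i = 1) (z : chart φ i) :
    slideBase φ hw (0, z) = φ z := by
  refine (represents_slideBase φ hw (0, z)).unique ?_
  simpa [slideVec] using represents_normalized z.2

theorem slideBase_one (φ : C(Z, RealProjectiveSpace s)) (hw : w i = 1) (z : chart φ i)
    {p : RealProjectiveSpace s} (hp : Represents w p) : slideBase φ hw (1, z) = p := by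
  refine (represents_slideBase φ hw (1, z)).unique ?_
  simpa [slideVec] using hp

theorem entry_self_ne_zero_of_mul_pos {i j : Fin (s + 1)} {p p' : RealProjectiveSpace s}
    (h : 0 < entry i j p * entry i j p') : entry i i p ≠ 0 ∧ entry i i p' ≠ 0 := by
  obtain ⟨h₁, h₂⟩ := mul_ne_zero_iff.1 h.ne'
  obtain ⟨v, hv⟩ := exists_represents p
  obtain ⟨v', hv'⟩ := exists_represents p'
  have k₁ := ((hv.entry_ne_zero_iff _ _).1 h₁).1
  have k₂ := ((hv'.entry_ne_zero_iff _ _).1 h₂).1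
  exact ⟨(hv.entry_ne_zero_iff _ _).2 ⟨k₁, k₁⟩, (hv'.entry_ne_zero_iff _ _).2 ⟨k₂, k₂⟩⟩

theorem entry_slideBase_ne_zero (φ : C(Z, RealProjectiveSpace s)) {i j : Fin (s + 1)}
    {z : Z} {p : RealProjectiveSpace s} (h : 0 < entry i j (φ z) * entry i j p)
    {t : ℝ} (ht : t ∈ unitInterval) :
    entry i j (slideBase φ (normalized_self (entry_self_ne_zero_of_mul_pos h).2)
      (t, ⟨z, (entry_self_ne_zero_of_mul_pos h).1⟩)) ≠ 0 := by
  obtain ⟨h₁, h₂⟩ := entry_self_ne_zero_of_mul_pos h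
  refine ((represents_slideBase φ (normalized_self h₂) (t, ⟨z, h₁⟩)).entry_ne_zero_iff i j).2
    ⟨?_, slideVec_apply_ne_zero h₁ h₂ h ht⟩
  rw [slideVec_self (normalized_self h₂) t h₁]
  exact one_ne_zero

/-- The point `[1, …, 1]`, common to all affine charts. -/
def centre (s : ℕ) : RealProjectiveSpace s := RealProjectiveSpace.mk 1 one_ne_zero

theorem represents_centre (s : ℕ) : Represents 1 (centre s) := represents_mk _

/-- Every `1`-cocycle of `ℝP^s` is cohomologous to a multiple of the tautological one. -/
theorem exists_sub_smul_tautCochain_mem_coboundaries_projective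
    {c : Cochain 1 (RealProjectiveSpace s)} (hc : c ∈ cocycles 1 (RealProjectiveSpace s)) :
    ∃ e : ZMod 2, c - e • tautCochain s ∈ coboundaries 1 (RealProjectiveSpace s) := by
  refine exists_sub_smul_tautCochain_mem_coboundaries (ContinuousMap.id _) Function.surjective_id
    ?_ hc ?_
  · intro i j z z' h
    obtain ⟨h₁, h₂⟩ := entry_self_ne_zero_of_mul_pos h
    refine JoinedIn.ofLine
      (f := fun t => slideBase (ContinuousMap.id _) (normalized_self h₂) (t, ⟨z, h₁⟩))
      (by fun_prop) (slideBase_zero _ _ _) (slideBase_one _ _ _ (represents_normalized h₂)) ?_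
    rintro _ ⟨t, ht, rfl⟩
    exact entry_slideBase_ne_zero (ContinuousMap.id _) h ht
  · intro i
    have h := cochainMap_sub_cochainMap_mem_coboundaries hc
      (slideBase (w := 1) (i := i) (ContinuousMap.id _) rfl) (incl (chart (ContinuousMap.id _) i))
      (ContinuousMap.const _ (centre s)) (slideBase_zero _ rfl)
      (fun z => slideBase_one _ rfl z (represents_centre s))
    have h0 : cochainMap 1 (ContinuousMap.const (chart (ContinuousMap.id _) i) (centre s)) c = 0 := by
      ext σ
      exact cocycle_const hc _
    rwa [h0, sub_zero] at h

end Contraction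

/-! ### The Milnor manifold over projective space -/

section MilnorManifold

variable {s n : ℕ}

theorem mem_realMilnorSet_iff {v w : Fin (s + 1) → ℝ} {p q : RealProjectiveSpace s}
    (hv : Represents v p) (hw : Represents w q) : (p, q) ∈ realMilnorSet s ↔ v ⬝ᵥ w = 0 := by
  obtain ⟨hv, rfl⟩ := hv
  obtain ⟨hw, rfl⟩ := hw
  exact mk_mem_realMilnorSet v w hv hw

/-- The correction in the `i`-th coordinate; for `xᵢ = 1` it is a projection onto the hyperplane
orthogonal to `x`. -/
def shear (x : Fin (s + 1) → ℝ) (i : Fin (s + 1)) :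
    (Fin (s + 1) → ℝ) →ₗ[ℝ] (Fin (s + 1) → ℝ) where
  toFun v := v - Pi.single i (x ⬝ᵥ v)
  map_add' v v' := by
    rw [dotProduct_add, Pi.single_add]
    abel
  map_smul' r v := by
    rw [dotProduct_smul, Pi.single_smul, RingHom.id_apply, smul_sub]

theorem shear_apply (x : Fin (s + 1) → ℝ) (i : Fin (s + 1)) (v : Fin (s + 1) → ℝ) :
    shear x i v = v - Pi.single i (x ⬝ᵥ v) := rfl

theorem dotProduct_shear {x : Fin (s + 1) → ℝ} {i : Fin (s + 1)} (hx : x i = 1)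
    (v : Fin (s + 1) → ℝ) : x ⬝ᵥ shear x i v = 0 := by
  rw [shear_apply, dotProduct_sub, dotProduct_single, hx, one_mul, sub_self]

theorem shear_eq_self {x v : Fin (s + 1) → ℝ} (h : x ⬝ᵥ v = 0) (i : Fin (s + 1)) :
    shear x i v = v := by
  rw [shear_apply, h, Pi.single_zero, sub_zero]

theorem shear_ne_zero (x : Fin (s + 1) → ℝ) {i : Fin (s + 1)} {u v : Fin (s + 1) → ℝ}
    (hu : u i = 1) (h : u ⬝ᵥ v = 0) (hv : v ≠ 0) : shear x i v ≠ 0 := by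
  intro h0
  rw [shear_apply, sub_eq_zero] at h0
  rw [h0, dotProduct_single, hu, one_mul] at h
  rw [h, Pi.single_zero] at h0
  exact hv h0

theorem continuous_shear {Z : Type*} [TopologicalSpace Z] {x : Z → Fin (s + 1) → ℝ}
    (hx : Continuous x) (i : Fin (s + 1)) :
    Continuous fun q : Z × (Fin (s + 1) → ℝ) => shear (x q.1) i q.2 := by
  simp only [shear_apply]
  have h : Continuous fun q : Z × (Fin (s + 1) → ℝ) => x q.1 ⬝ᵥ q.2 :=
    continuous_finsetSum _ fun k _ => by fun_prop
  refine continuous_snd.sub (continuous_pi fun j => ?_)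
  simp only [Pi.single_apply]
  split_ifs
  exacts [h, continuous_const]

theorem normalized_dotProduct {i : Fin (s + 1)} (z : chart (projFst s) i)
    {v : Fin (s + 1) → ℝ} (hv : Represents v (projSnd s z)) :
    normalized i (projFst s z) ⬝ᵥ v = 0 :=
  (mem_realMilnorSet_iff (represents_normalized z.2) hv).1 z.1.2

variable {i : Fin (s + 1)} {w : Fin (s + 1) → ℝ}

/-- Lift of the straight-line homotopy in the `i`-th affine chart to the Milnor manifold,
correcting the second factor so that it stays orthogonal to the first. -/
def slideSnd (hw : w i = 1) : C(ℝ × chart (projFst s) i, RealProjectiveSpace s) :=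
  projMap ((projSnd s).comp ((incl _).comp ContinuousMap.snd))
    (fun q => shear (slideVec i w q.1 (projFst s q.2)) i)
    (continuous_shear (continuous_slideVec (projFst s)) i)
    fun q _ hv => shear_ne_zero _ (slideVec_self (t := 0) hw q.2.2) (by
      simpa [slideVec] using normalized_dotProduct q.2 hv) hv.ne_zero

theorem represents_slideSnd (hw : w i = 1) (q : ℝ × chart (projFst s) i)
    {v : Fin (s + 1) → ℝ} (hv : Represents v (projSnd s q.2)) :
    Represents (shear (slideVec i w q.1 (projFst s q.2)) i v) (slideSnd hw q) := by
  unfold slideSnd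
  refine represents_projMap _ _ _ _ (v := v) ?_ rfl
  exact hv

/-- The homotopy of the preimage of the `i`-th affine chart under `([x], [y]) ↦ [x]` into the fibre
over `[w]`. -/
def slide (hw : w i = 1) : C(ℝ × chart (projFst s) i, RealMilnor s) where
  toFun q := ⟨(slideBase (projFst s) hw q, slideSnd hw q), by
    obtain ⟨v, hv⟩ := exists_represents (projSnd s q.2)
    exact (mem_realMilnorSet_iff (represents_slideBase _ hw q) (represents_slideSnd hw q hv)).2
      (dotProduct_shear (slideVec_self hw q.1 q.2.2) v)⟩
  continuous_toFun := by
    refine Continuous.subtype_mk ?_ _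
    fun_prop

theorem slide_zero (hw : w i = 1) (z : chart (projFst s) i) : slide hw (0, z) = z := by
  obtain ⟨v, hv⟩ := exists_represents (projSnd s z)
  refine Subtype.ext (Prod.ext (slideBase_zero _ hw z) ?_)
  refine (represents_slideSnd hw (0, z) hv).unique ?_
  rw [shear_eq_self]
  · exact hv
  · simpa [slideVec] using normalized_dotProduct z hv

theorem joinedIn_fibre {z z' : RealMilnor s} (h : projFst s z = projFst s z') :
    JoinedIn {y | projFst s y = projFst s z'} z z' := by
  by_cases he : projSnd s z = projSnd s z'
  · obtain rfl : z = z' := Subtype.ext (Prod.ext h he)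
    exact JoinedIn.refl rfl
  obtain ⟨x, hx⟩ := exists_represents (projFst s z')
  obtain ⟨v, hv⟩ := exists_represents (projSnd s z)
  obtain ⟨v', hv'⟩ := exists_represents (projSnd s z')
  have hxv : x ⬝ᵥ v = 0 :=
    (mem_realMilnorSet_iff (h.symm ▸ hx : Represents x (projFst s z)) hv).1 z.2
  have hxv' : x ⬝ᵥ v' = 0 := (mem_realMilnorSet_iff hx hv').1 z'.2
  let f (t : ℝ) : Fin (s + 1) → ℝ := (1 - t) • v + t • v'
  have hf : Continuous f := by fun_prop
  have hne : ∀ t, f t ≠ 0 := by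
    intro t ht
    by_cases h0 : t = 0
    · subst h0
      exact hv.ne_zero (by simpa [f] using ht)
    by_cases h1 : 1 - t = 0
    · rw [← sub_eq_zero.1 h1] at ht
      exact hv'.ne_zero (by simpa [f] using ht)
    · have e : (-t) • v' = (1 - t) • v := by
        rw [neg_smul]
        exact (eq_neg_of_add_eq_zero_left ht).symm
      exact he ((hv.smul h1).unique (e ▸ hv'.smul (neg_ne_zero.2 h0)))
  have hmem : ∀ t, (projFst s z', RealProjectiveSpace.mk (f t) (hne t)) ∈ realMilnorSet s := by
    intro t
    rw [mem_realMilnorSet_iff hx (represents_mk (hne t))]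
    simp [f, hxv, hxv']
  refine JoinedIn.ofLine (f := fun t => ⟨_, hmem t⟩)
    (Continuous.continuousOn (Continuous.subtype_mk
      (continuous_const.prodMk (continuous_mk hf hne)) _)) ?_ ?_ ?_
  · refine Subtype.ext (Prod.ext h.symm ((represents_mk (hne 0)).unique ?_))
    change Represents (f 0) (projSnd s z)
    simpa [f] using hv
  · refine Subtype.ext (Prod.ext rfl ((represents_mk (hne 1)).unique ?_))
    change Represents (f 1) (projSnd s z')
    simpa [f] using hv'
  · rintro _ ⟨t, -, rfl⟩
    rfl

/-- The preimages in the Milnor manifold of the two components of the overlap of two charts are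
path connected: move along a segment in the base, then within a fibre. -/
theorem joinedIn_overlap {i j : Fin (s + 1)} {z z' : RealMilnor s}
    (h : 0 < entry i j (projFst s z) * entry i j (projFst s z')) :
    JoinedIn {y | entry i j (projFst s y) ≠ 0} z z' := by
  obtain ⟨h₁, h₂⟩ := entry_self_ne_zero_of_mul_pos h
  have hw := normalized_self h₂
  have step₁ : JoinedIn {y | entry i j (projFst s y) ≠ 0} z (slide hw (1, ⟨z, h₁⟩)) := by
    refine JoinedIn.ofLine (f := fun t => slide hw (t, ⟨z, h₁⟩)) (by fun_prop)
      (slide_zero hw ⟨z, h₁⟩) rfl ?_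
    rintro _ ⟨t, ht, rfl⟩
    exact entry_slideBase_ne_zero (projFst s) h ht
  have step₂ : JoinedIn {y | projFst s y = projFst s z'} (slide hw (1, ⟨z, h₁⟩)) z' :=
    joinedIn_fibre (slideBase_one (projFst s) hw ⟨z, h₁⟩ (represents_normalized h₂))
  refine step₁.trans (step₂.mono fun y hy => ?_)
  rw [Set.mem_ofPred_eq, show projFst s y = projFst s z' from hy]
  exact (mul_ne_zero_iff.1 h.ne').2

theorem projFst_surjective (hs : 1 ≤ s) : Function.Surjective (projFst s) := by
  intro p
  obtain ⟨v, hv⟩ := exists_represents p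
  obtain ⟨i, hi⟩ := Function.ne_iff.1 hv.ne_zero
  obtain ⟨j, hj⟩ : ∃ j, j ≠ i := by
    have : Nontrivial (Fin (s + 1)) := Fin.nontrivial_iff_two_le.2 (by omega)
    exact exists_ne i
  have hne : Pi.single j (v i) - Pi.single i (v j) ≠ (0 : Fin (s + 1) → ℝ) := by
    intro h
    have := congrFun h j
    simp [hj] at this
    exact hi this
  refine ⟨⟨(p, RealProjectiveSpace.mk _ hne), ?_⟩, rfl⟩
  rw [mem_realMilnorSet_iff hv (represents_mk hne), dotProduct_sub, dotProduct_single,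
    dotProduct_single]
  ring

/-- The linear identification of `ℝ^{n+1}` with the hyperplane orthogonal to `(1, …, 1)`. -/
def fibreLin (n : ℕ) : (Fin (n + 1) → ℝ) →ₗ[ℝ] (Fin (n + 1 + 1) → ℝ) where
  toFun v := Fin.cons (-∑ i, v i) v
  map_add' v v' := by
    ext j
    refine Fin.cases ?_ (fun k => ?_) j
    · simp [Finset.sum_add_distrib, add_comm]
    · simp
  map_smul' r v := by
    ext j
    refine Fin.cases ?_ (fun k => ?_) j
    · simp [Finset.mul_sum]
    · simp

theorem fibreLin_ne_zero {v : Fin (n + 1) → ℝ} (hv : v ≠ 0) : fibreLin n v ≠ 0 := by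
  intro h
  refine hv (funext fun k => ?_)
  simpa [fibreLin] using congrFun h k.succ

theorem one_dotProduct_fibreLin (v : Fin (n + 1) → ℝ) : 1 ⬝ᵥ fibreLin n v = 0 := by
  simp [fibreLin, Fin.sum_univ_succ, dotProduct]

theorem fibreLin_tail {v : Fin (n + 1 + 1) → ℝ} (hv : 1 ⬝ᵥ v = 0) :
    fibreLin n (LinearMap.funLeft ℝ ℝ Fin.succ v) = v := by
  have h : v 0 + ∑ k : Fin (n + 1), v k.succ = 0 := by
    simpa [dotProduct, Fin.sum_univ_succ (n := n + 1)] using hv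
  ext j
  refine Fin.cases ?_ (fun k => ?_) j
  · simp [fibreLin, LinearMap.funLeft_apply]
    linarith
  · simp [fibreLin, LinearMap.funLeft_apply]

/-- The embedding of `ℝP^n` in `ℝP^{n+1}` as the hyperplane orthogonal to `[1, …, 1]`. -/
def hyperplaneMap (n : ℕ) : C(RealProjectiveSpace n, RealProjectiveSpace (n + 1)) :=
  projMap (ContinuousMap.id _) (fun _ => fibreLin n)
    ((fibreLin n).continuous_of_finiteDimensional.comp continuous_snd)
    fun _ _ hv => fibreLin_ne_zero hv.ne_zero

theorem represents_hyperplaneMap {v : Fin (n + 1) → ℝ} {p : RealProjectiveSpace n}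
    (hv : Represents v p) : Represents (fibreLin n v) (hyperplaneMap n p) := by
  unfold hyperplaneMap
  refine represents_projMap _ _ _ _ (v := v) ?_ rfl
  exact hv

/-- The fibre of `([x], [y]) ↦ [x]` over `[1, …, 1]`. -/
def fibreIncl (n : ℕ) : C(RealProjectiveSpace n, RealMilnor (n + 1)) where
  toFun p := ⟨(centre (n + 1), hyperplaneMap n p), by
    obtain ⟨v, hv⟩ := exists_represents p
    exact (mem_realMilnorSet_iff (represents_centre _) (represents_hyperplaneMap hv)).2
      (one_dotProduct_fibreLin v)⟩
  continuous_toFun := Continuous.subtype_mk (continuous_const.prodMk (by fun_prop)) _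

theorem tail_shear_ne_zero {i : Fin (n + 1 + 1)} (z : chart (projFst (n + 1)) i)
    {v : Fin (n + 1 + 1) → ℝ} (hv : Represents v (projSnd (n + 1) z)) :
    LinearMap.funLeft ℝ ℝ Fin.succ (shear 1 i v) ≠ 0 := by
  intro h
  have h₁ := fibreLin_tail (dotProduct_shear (x := 1) (i := i) rfl v)
  rw [h, map_zero] at h₁
  exact shear_ne_zero 1 (normalized_self z.2) (normalized_dotProduct z hv) hv.ne_zero h₁.symm

/-- The retraction of the preimage of a chart to the fibre over `[1, …, 1]`. -/
def fibreRetract (n : ℕ) (i : Fin (n + 1 + 1)) :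
    C(chart (projFst (n + 1)) i, RealProjectiveSpace n) :=
  projMap ((projSnd (n + 1)).comp (incl _))
    (fun _ => (LinearMap.funLeft ℝ ℝ Fin.succ).comp (shear 1 i))
    ((LinearMap.continuous_of_finiteDimensional _).comp continuous_snd)
    fun z _ hv => tail_shear_ne_zero z hv

theorem slide_one {i : Fin (n + 1 + 1)} (z : chart (projFst (n + 1)) i) :
    slide (w := 1) (i := i) rfl (1, z) = (fibreIncl n).comp (fibreRetract n i) z := by
  obtain ⟨v, hv⟩ := exists_represents (projSnd (n + 1) z)
  have h : Represents (LinearMap.funLeft ℝ ℝ Fin.succ (shear 1 i v)) (fibreRetract n i z) := by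
    unfold fibreRetract
    refine represents_projMap _ _ _ _ (v := v) ?_ rfl
    exact hv
  refine Subtype.ext (Prod.ext (slideBase_one _ rfl z (represents_centre _)) ?_)
  refine (represents_slideSnd rfl (1, z) hv).unique ?_
  have h' := represents_hyperplaneMap h
  rw [fibreLin_tail (dotProduct_shear (x := 1) (i := i) rfl v)] at h'
  have e : slideVec i 1 1 (projFst (n + 1) z) = 1 := by simp [slideVec]
  rw [e]
  exact h'

/-- The second tautological cocycle restricts to the tautological cocycle of the fibre. -/
theorem fibreIncl_projSnd_sub_mem_coboundaries (n : ℕ) :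
    cochainMap 1 (fibreIncl n) (cochainMap 1 (projSnd (n + 1)) (tautCochain (n + 1))) -
      tautCochain n ∈ coboundaries 1 (RealProjectiveSpace n) :=
  cochainMap_tautCochain_sub_mem_coboundaries (fibreLin n) (hyperplaneMap n)
    fun _ _ hv => represents_hyperplaneMap hv

/-- The first tautological cocycle restricts to zero on the fibre. -/
theorem fibreIncl_projFst_eq_zero (n : ℕ) :
    cochainMap 1 (fibreIncl n) (cochainMap 1 (projFst (n + 1)) (tautCochain (n + 1))) = 0 := by
  ext σ
  exact cocycle_const (tautCochain_mem_cocycles (n + 1)) (centre (n + 1))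

/-- Every `1`-cocycle of the Milnor manifold is cohomologous to a combination of the two
tautological ones. -/
theorem exists_sub_smul_sub_smul_mem_coboundaries {c : Cochain 1 (RealMilnor (n + 1))}
    (hc : c ∈ cocycles 1 (RealMilnor (n + 1))) :
    ∃ e m : ZMod 2, c - m • cochainMap 1 (projSnd (n + 1)) (tautCochain (n + 1)) -
      e • cochainMap 1 (projFst (n + 1)) (tautCochain (n + 1)) ∈
        coboundaries 1 (RealMilnor (n + 1)) := by
  obtain ⟨m, hm⟩ := exists_sub_smul_tautCochain_mem_coboundaries_projective
    (cochainMap_mem_cocycles 1 (fibreIncl n) c hc)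
  let d : Cochain 1 (RealMilnor (n + 1)) :=
    c - m • cochainMap 1 (projSnd (n + 1)) (tautCochain (n + 1))
  have hd : d ∈ cocycles 1 (RealMilnor (n + 1)) := sub_mem hc (Submodule.smul_mem _ _
    (cochainMap_mem_cocycles 1 _ _ (tautCochain_mem_cocycles (n + 1))))
  have hfib : cochainMap 1 (fibreIncl n) d ∈ coboundaries 1 (RealProjectiveSpace n) := by
    have h := sub_mem hm (Submodule.smul_mem _ m (fibreIncl_projSnd_sub_mem_coboundaries n))
    convert h using 1
    simp only [d, map_sub, map_smul, smul_sub]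
    abel
  obtain ⟨e, he⟩ := exists_sub_smul_tautCochain_mem_coboundaries (projFst (n + 1))
    (projFst_surjective (Nat.le_add_left 1 n)) (fun _ _ _ _ h => joinedIn_overlap h) hd (by
      intro i
      have h₁ := cochainMap_sub_cochainMap_mem_coboundaries hd (slide (w := 1) (i := i) rfl)
        (incl _) ((fibreIncl n).comp (fibreRetract n i)) (slide_zero rfl) slide_one
      have h₂ := cochainMap_mem_coboundaries 1 (fibreRetract n i) _ hfib
      have h := add_mem h₁ h₂
      rwa [show cochainMap 1 ((fibreIncl n).comp (fibreRetract n i)) d =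
        cochainMap 1 (fibreRetract n i) (cochainMap 1 (fibreIncl n) d) from rfl,
        sub_add_cancel] at h)
  exact ⟨e, m, he⟩

end MilnorManifold

/-! ### Cohomology classes -/

section Classes

variable {X Y : Type*} [TopologicalSpace X] [TopologicalSpace Y]

/-- The first cohomology class of a cocycle. -/
def cohomologyClass (c : Cochain 1 X) (hc : c ∈ cocycles 1 X) : Cohomology 1 X :=
  Submodule.Quotient.mk ⟨c, hc⟩

theorem cohomologyClass_eq_zero_iff {c : Cochain 1 X} (hc : c ∈ cocycles 1 X) :
    cohomologyClass c hc = 0 ↔ c ∈ coboundaries 1 X :=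
  Submodule.Quotient.mk_eq_zero _

theorem exists_cohomologyClass_eq (x : Cohomology 1 X) : ∃ c hc, cohomologyClass c hc = x := by
  obtain ⟨⟨c, hc⟩, h⟩ := Submodule.Quotient.mk_surjective _ x
  exact ⟨c, hc, h⟩

theorem cohomologyMap_comp_apply {Z : Type*} [TopologicalSpace Z] (f : C(X, Y)) (g : C(Y, Z))
    (x : Cohomology 1 Z) :
    cohomologyMap 1 f (cohomologyMap 1 g x) = cohomologyMap 1 (g.comp f) x := by
  obtain ⟨c, hc, rfl⟩ := exists_cohomologyClass_eq x
  rfl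

/-- The first Stiefel–Whitney class of the tautological line bundle of `ℝP^s`. -/
def tautClass (s : ℕ) : Cohomology 1 (RealProjectiveSpace s) :=
  cohomologyClass (tautCochain s) (tautCochain_mem_cocycles s)

theorem tautClass_ne_zero {s : ℕ} (hs : 1 ≤ s) : tautClass s ≠ 0 := fun h =>
  tautCochain_notMem_coboundaries hs ((cohomologyClass_eq_zero_iff _).1 h)

theorem exists_eq_smul_tautClass {s : ℕ} (x : Cohomology 1 (RealProjectiveSpace s)) :
    ∃ e : ZMod 2, x = e • tautClass s := by
  obtain ⟨c, hc, rfl⟩ := exists_cohomologyClass_eq x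
  obtain ⟨e, he⟩ := exists_sub_smul_tautCochain_mem_coboundaries_projective hc
  refine ⟨e, sub_eq_zero.1 ?_⟩
  exact (cohomologyClass_eq_zero_iff
    (sub_mem hc (Submodule.smul_mem _ e (tautCochain_mem_cocycles s)))).2 he

theorem span_tautClasses (n : ℕ) :
    Submodule.span (ZMod 2) {cohomologyMap 1 (projFst (n + 1)) (tautClass (n + 1)),
      cohomologyMap 1 (projSnd (n + 1)) (tautClass (n + 1))} = ⊤ := by
  refine (Submodule.eq_top_iff').2 fun x => Submodule.mem_span_pair.2 ?_
  obtain ⟨c, hc, rfl⟩ := exists_cohomologyClass_eq x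
  obtain ⟨e, m, h⟩ := exists_sub_smul_sub_smul_mem_coboundaries hc
  have hcoc : ∀ q : C(RealMilnor (n + 1), RealProjectiveSpace (n + 1)),
      cochainMap 1 q (tautCochain (n + 1)) ∈ cocycles 1 (RealMilnor (n + 1)) :=
    fun q => cochainMap_mem_cocycles 1 q _ (tautCochain_mem_cocycles (n + 1))
  have h₀ : cohomologyClass c hc -
      m • cohomologyMap 1 (projSnd (n + 1)) (tautClass (n + 1)) -
      e • cohomologyMap 1 (projFst (n + 1)) (tautClass (n + 1)) = 0 :=
    (cohomologyClass_eq_zero_iff (sub_mem (sub_mem hc (Submodule.smul_mem _ m (hcoc _)))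
      (Submodule.smul_mem _ e (hcoc _)))).2 h
  refine ⟨e, m, ?_⟩
  rw [← sub_eq_zero.1 h₀, sub_add_cancel]

theorem cohomologyMap_fibreIncl_projFst (n : ℕ) :
    cohomologyMap 1 (fibreIncl n) (cohomologyMap 1 (projFst (n + 1)) (tautClass (n + 1))) = 0 :=
  (cohomologyClass_eq_zero_iff (cochainMap_mem_cocycles 1 _ _
    (cochainMap_mem_cocycles 1 _ _ (tautCochain_mem_cocycles (n + 1))))).2 (by
    rw [fibreIncl_projFst_eq_zero]
    exact zero_mem _)

theorem cohomologyMap_fibreIncl_projSnd (n : ℕ) :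
    cohomologyMap 1 (fibreIncl n) (cohomologyMap 1 (projSnd (n + 1)) (tautClass (n + 1))) =
      tautClass n :=
  sub_eq_zero.1 ((cohomologyClass_eq_zero_iff (sub_mem (cochainMap_mem_cocycles 1 _ _
    (cochainMap_mem_cocycles 1 _ _ (tautCochain_mem_cocycles (n + 1))))
    (tautCochain_mem_cocycles n))).2 (fibreIncl_projSnd_sub_mem_coboundaries n))

theorem swapMap_ne_self {s : ℕ} (p : RealMilnor s) : swapMap s p ≠ p := by
  intro h
  obtain ⟨v, hv⟩ := exists_represents p.1.1
  have e : p.1.2 = p.1.1 := congrArg (fun q : RealMilnor s => q.1.1) h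
  exact (dotProduct_self_pos hv.ne_zero).ne'
    ((mem_realMilnorSet_iff hv (e ▸ hv : Represents v p.1.2)).1 p.2)

theorem cohomologyMap_swapMap_projFst {s : ℕ} (u : Cohomology 1 (RealProjectiveSpace s)) :
    cohomologyMap 1 (swapMap s) (cohomologyMap 1 (projFst s) u) =
      cohomologyMap 1 (projSnd s) u :=
  cohomologyMap_comp_apply _ _ _

theorem linearIndependent_tautClasses {n : ℕ} (hn : 1 ≤ n) :
    LinearIndependent (ZMod 2) ![cohomologyMap 1 (projFst (n + 1)) (tautClass (n + 1)),
      cohomologyMap 1 (projSnd (n + 1)) (tautClass (n + 1))] := by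
  have hu := tautClass_ne_zero hn
  have hb : ∀ r : ZMod 2,
      r • cohomologyMap 1 (projSnd (n + 1)) (tautClass (n + 1)) = 0 → r = 0 := by
    intro r hr
    have := congrArg (cohomologyMap 1 (fibreIncl n)) hr
    rw [map_smul, cohomologyMap_fibreIncl_projSnd, map_zero] at this
    exact (smul_eq_zero.1 this).resolve_right hu
  rw [LinearIndependent.pair_iff]
  intro r t h
  have ht : t = 0 := by
    have := congrArg (cohomologyMap 1 (fibreIncl n)) h
    rw [map_add, map_smul, map_smul, cohomologyMap_fibreIncl_projFst,
      cohomologyMap_fibreIncl_projSnd, smul_zero, zero_add, map_zero] at this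
    exact (smul_eq_zero.1 this).resolve_right hu
  refine ⟨hb r ?_, ht⟩
  rw [ht, zero_smul, add_zero] at h
  have := congrArg (cohomologyMap 1 (swapMap (n + 1))) h
  rwa [map_smul, cohomologyMap_swapMap_projFst, map_zero] at this

end Classes

end Milnor

end

theorem proposition5p1 (s : ℕ) (hs : 1 ≤ s) :
    -- `A` is a free involution
    (∀ p : Milnor.RealMilnor s, Milnor.swapMap s (Milnor.swapMap s p) = p) ∧
    (∀ p : Milnor.RealMilnor s, Milnor.swapMap s p ≠ p) ∧
    -- `u` is the generator of `H¹(ℝP^s; ℤ/2)`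
    (∃ u : Milnor.Cohomology 1 (Milnor.RealProjectiveSpace s),
      u ≠ 0 ∧ (∀ v, v = 0 ∨ v = u) ∧
      -- `a` and `b` generate `H¹(ℝH_{s,s}; ℤ/2)`, and `A` exchanges them
      ∃ a b : Milnor.Cohomology 1 (Milnor.RealMilnor s),
        a = Milnor.cohomologyMap 1 (Milnor.projFst s) u ∧
        b = Milnor.cohomologyMap 1 (Milnor.projSnd s) u ∧
        Submodule.span (ZMod 2) {a, b} = ⊤ ∧
        (2 ≤ s → LinearIndependent (ZMod 2) ![a, b]) ∧
        Milnor.cohomologyMap 1 (Milnor.swapMap s) a = b) ∧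
    -- `A` acts nontrivially on mod 2 cohomology
    (2 ≤ s → Milnor.cohomologyMap 1 (Milnor.swapMap s) ≠ LinearMap.id) := by
  obtain ⟨n, rfl⟩ : ∃ n, s = n + 1 := ⟨s - 1, by omega⟩
  refine ⟨fun _ => rfl, Milnor.swapMap_ne_self, ⟨Milnor.tautClass (n + 1),
    Milnor.tautClass_ne_zero hs, fun v => ?_, _, _, rfl, rfl, Milnor.span_tautClasses n,
    fun h => Milnor.linearIndependent_tautClasses (by omega),
    Milnor.cohomologyMap_swapMap_projFst _⟩, fun h hid => ?_⟩
  · obtain ⟨e, rfl⟩ := Milnor.exists_eq_smul_tautClass v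
    have he : ∀ e : ZMod 2, e = 0 ∨ e = 1 := by decide
    rcases he e with rfl | rfl
    · exact Or.inl (zero_smul _ _)
    · exact Or.inr (one_smul _ _)
  · have hli := Milnor.linearIndependent_tautClasses (n := n) (by omega)
    have hab := Milnor.cohomologyMap_swapMap_projFst (Milnor.tautClass (n + 1))
    rw [hid, LinearMap.id_apply] at hab
    exact zero_ne_one (hli.injective (a₁ := 0) (a₂ := 1) hab)
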